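/- Let $d\ge 1$. Identify the set $B_d$ of open balls $b(x,r)\subset\mathbb R^d$ with $\mathbb R^d\times(0,\infty)$, and let $C(B_d)$ be the space of continuous functions $B_d\to\mathbb R$ with the topology of uniform convergence on compact sets and its Borel $\sigma$-algebra. Let $E_d$ be the group of all isometries of $\mathbb R^d$ (reflections included). It acts by $(gf)(x)=f(g^{-1}x)$ on the real Hilbert space $L^2(\mathbb R^d)$, by $g\cdot(x,r)=(gx,r)$ on $B_d$, by $(g\cdot f)(b)=f(g^{-1}\cdot b)$ on $C(B_d)$, and by $(g\cdot\Psi)(f)=\Psi(g^{-1}\cdot f)$ on functions $\Psi:C(B_d)\to\mathbb C$. Write the points of $\mathbb R^d$ as $(t,x_1,\dots,x_{d-1})$, put $\mathbb R^d_+=\{t>0\}$ and $\theta(t,x_1,\dots,x_{d-1})=(-t,x_1,\dots,x_{d-1})$, and let $B_d^+$ be the set of $(x,r)\in B_d$ with $b(x,r)\subseteq\mathbb R^d_+$. Let $A$ be a bounded selfadjoint operator on $L^2(\mathbb R^d)$ that is strictly positive, i.e. $\langle f,Af\rangle>0$ for all $f\ne0$. Put $$A(x,r,y,s)=\langle v_r1_{b(x,r)},\,A\,v_s1_{b(y,s)}\rangle_{L^2(\mathbb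 R^d)},$$ where $v_r$ is the reciprocal of the volume of a ball of radius $r$. There is exactly one Borel probability measure $\widetilde\mu_A$ on $C(B_d)$ under which the evaluations $f\mapsto f(x,r)$ form a centred (jointly) Gaussian random field with covariance $A(x,r,y,s)$, and it has the following properties. (1) If $A$ commutes with the action of $E_d$ on $L^2(\mathbb R^d)$, then $\widetilde\mu_A$ is $E_d$-invariant: its image under the action of each $g\in E_d$ on $C(B_d)$ is $\widetilde\mu_A$. (2) Suppose that $A$ commutes with the action of $\theta$ on $L^2(\mathbb R^d)$ and that $A$ is reflection positive, i.e. $\langle Af,\theta f\rangle_{L^2}\ge0$ for all real-valued $f\in C_c^\infty(\mathbb R^d_+)$. Then $\widetilde\mu_A$ is reflection positive: the number $$\int_{C(B_d)}\Psi\;\overline{\theta\cdot\Psi}\;d\widetilde\mu_A$$ is real and nonnegative for every $\Psi:C(B_d)\to\mathbb C$ of the form $\Psi=\Psi'\circ R$, where $R:C(B_d)\to C(B_d^+)$ is the restriction map and $\Psi':C(B_d^+)\to\mathbb C$ is bounded and Borel measurable. -/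

import Mathlib

open MeasureTheory ProbabilityTheory
open scoped ComplexConjugate ContDiff

noncomputable section

namespace BallField

/-- `ℝ^d` with its Euclidean structure. The coordinate `t` is the one with index `0`. -/
abbrev Space (d : ℕ) : Type := EuclideanSpace ℝ (Fin d)

/-- The set of all open balls in `ℝ^d`, identified with `ℝ^d × (0, ∞)`; the pair `(x, r)` stands
for the open ball of radius `r` centred at `x`. -/
abbrev BallSpace (d : ℕ) : Type := Space d × Set.Ioi (0 : ℝ)

/-- The real Hilbert space `L²(ℝ^d)`. -/
abbrev L2 (d : ℕ) : Type := Lp ℝ 2 (volume : Measure (Space d))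

/-- The group of all Euclidean motions (isometries, reflections included) of `ℝ^d`. -/
abbrev Motion (d : ℕ) : Type := Space d ≃ᵢ Space d

/-- `C(X)`, whose Mathlib topology is that of uniform convergence on compact sets, carries its
Borel σ-algebra. -/
instance instMeasurableSpaceContinuousMap (X : Type*) [TopologicalSpace X] :
    MeasurableSpace C(X, ℝ) := borel _

instance instBorelSpaceContinuousMap (X : Type*) [TopologicalSpace X] :
    BorelSpace C(X, ℝ) := ⟨rfl⟩

/-! ### The action of Euclidean motions -/

theorem measurePreserving_motion {d : ℕ} (g : Motion d) :
    MeasurePreserving g (volume : Measure (Space d)) volume := by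
  have h : (g : Space d → Space d) = (fun x => x + g 0) ∘
      (g.toRealAffineIsometryEquiv.linearIsometryEquiv : Space d → Space d) := by
    funext x
    have := g.toRealAffineIsometryEquiv.map_vadd 0 x
    simpa using this
  rw [h]
  exact (measurePreserving_add_right volume (g 0)).comp (LinearIsometryEquiv.measurePreserving _)

/-- The natural unitary representation on `L²(ℝ^d)`: `(g · f)(x) = f (g⁻¹ x)`. -/
def actL2 {d : ℕ} (g : Motion d) : L2 d →ₗᵢ[ℝ] L2 d :=
  Lp.compMeasurePreservingₗᵢ ℝ g.symm (measurePreserving_motion g.symm)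

/-- The action on balls, `g · (x, r) = (g x, r)`. -/
def actBall {d : ℕ} (g : Motion d) : C(BallSpace d, BallSpace d) where
  toFun b := (g b.1, b.2)
  continuous_toFun := (g.continuous.comp continuous_fst).prodMk continuous_snd

/-- The induced action on continuous functions of balls, `(g · f)(b) = f (g⁻¹ · b)`. -/
def actFun {d : ℕ} (g : Motion d) (f : C(BallSpace d, ℝ)) : C(BallSpace d, ℝ) :=
  f.comp (actBall g.symm)

/-- A Borel measure on `C(B_d)` is Euclidean invariant if it is its own image under every motion. -/
def IsInvariantMeasure {d : ℕ} (ν : Measure C(BallSpace d, ℝ)) : Prop :=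
  ∀ g : Motion d, ν.map (actFun g) = ν

/-- A bounded operator commutes with the natural representation of the Euclidean group. -/
def IsInvariantOperator {d : ℕ} (A : L2 d →L[ℝ] L2 d) : Prop :=
  ∀ (g : Motion d) (f : L2 d), A (actL2 g f) = actL2 g (A f)

/-! ### The Gaussian measure of an operator -/

/-- A strictly positive selfadjoint bounded operator. -/
def IsStrictlyPositiveOperator {d : ℕ} (A : L2 d →L[ℝ] L2 d) : Prop :=
  IsSelfAdjoint A ∧ ∀ f : L2 d, f ≠ 0 → 0 < inner ℝ f (A f)

/-- The function `v_r 1_{b(x, r)}` in `L²(ℝ^d)`, with `v_r` the reciprocal of the volume of a ball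
of radius `r`. -/
def ballVec {d : ℕ} (b : BallSpace d) : L2 d :=
  (volume.real (Metric.ball (0 : Space d) b.2))⁻¹ •
    indicatorConstLp 2 (measurableSet_ball (x := b.1) (ε := (b.2 : ℝ)))
      (measure_ball_lt_top (μ := volume)).ne (1 : ℝ)

/-- The kernel `A(x, r, y, s) = ⟨v_r 1_{b(x, r)}, A (v_s 1_{b(y, s)})⟩`. -/
def kernel {d : ℕ} (A : L2 d →L[ℝ] L2 d) (b c : BallSpace d) : ℝ :=
  inner ℝ (ballVec b) (A (ballVec c))

/-- `X` is a (jointly) Gaussian random field on the probability space `(Ω, P)`, centred and with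
covariance `C`. -/
structure IsCenteredGaussianField {T Ω : Type*} [MeasurableSpace Ω] (X : T → Ω → ℝ)
    (C : T → T → ℝ) (P : Measure Ω) : Prop where
  isProbabilityMeasure : IsProbabilityMeasure P
  isGaussianProcess : IsGaussianProcess X P
  mean_eq_zero : ∀ t, ∫ w, X t w ∂P = 0
  covariance_eq : ∀ s t, ∫ w, X s w * X t w ∂P = C s t

/-- `ν` is the Gaussian measure on `C(B_d)` associated with `A`: under the Borel measure `ν` the
canonical field of evaluations is centred Gaussian with covariance `A(x, r, y, s)`. In other words,
`ν` is the law of the version with continuous paths of the Gaussian field with this covariance. -/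
def IsFieldMeasure {d : ℕ} (A : L2 d →L[ℝ] L2 d) (ν : Measure C(BallSpace d, ℝ)) : Prop :=
  IsCenteredGaussianField (fun (b : BallSpace d) (f : C(BallSpace d, ℝ)) => f b) (kernel A) ν

/-! ### Reflection positivity -/

/-- The open half-space `ℝ^d_+ = {t > 0}`. -/
def halfSpace (d : ℕ) [NeZero d] : Set (Space d) := {x | 0 < x 0}

/-- The reflection `θ : (t, x₁, …) ↦ (-t, x₁, …)`. -/
def reflection (d : ℕ) [NeZero d] : Motion d :=
  (LinearIsometryEquiv.piLpCongrRight 2 (fun i : Fin d =>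
    if i = 0 then LinearIsometryEquiv.neg ℝ else LinearIsometryEquiv.refl ℝ ℝ)).toIsometryEquiv

theorem reflection_apply (d : ℕ) [NeZero d] (x : Space d) (i : Fin d) :
    reflection d x i = if i = 0 then -x i else x i := by
  by_cases h : i = 0 <;> simp [reflection, h]

/-- `⟨A f, θ f⟩ ≥ 0` for all `f ∈ C_c^∞(ℝ^d_+)`. -/
def IsReflectionPositiveOperator {d : ℕ} [NeZero d] (A : L2 d →L[ℝ] L2 d) : Prop :=
  ∀ (f : Space d → ℝ) (hf : ContDiff ℝ ∞ f) (hc : HasCompactSupport f),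
    tsupport f ⊆ halfSpace d →
      0 ≤ inner ℝ (A ((hf.continuous.memLp_of_hasCompactSupport (p := 2) (μ := volume) hc).toLp f))
        (actL2 (reflection d)
          ((hf.continuous.memLp_of_hasCompactSupport (p := 2) (μ := volume) hc).toLp f))

/-- The set of balls contained in the open half-space `ℝ^d_+`. -/
def halfBalls (d : ℕ) [NeZero d] : Set (BallSpace d) :=
  {b | Metric.ball b.1 (b.2 : ℝ) ⊆ halfSpace d}

/-- `Ψ` is a bounded measurable complex function on `C(B_d)` that factors, through a bounded
measurable function on `C(V)`, over the restriction map `C(B_d) → C(V)`. -/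
def IsBoundedMeasurableOn {d : ℕ} (V : Set (BallSpace d)) (Ψ : C(BallSpace d, ℝ) → ℂ) : Prop :=
  ∃ Ψ' : C(V, ℝ) → ℂ, Measurable Ψ' ∧ (∃ K : ℝ, ∀ f, ‖Ψ' f‖ ≤ K) ∧
    ∀ f : C(BallSpace d, ℝ), Ψ f = Ψ' (f.restrict V)

/-- `∫ Ψ · conj (θ · Ψ) dν` is a nonnegative real number for all bounded measurable `Ψ` depending
only on balls in the half-space, where `(θ · Ψ)(f) = Ψ (θ⁻¹ · f)`. -/
def IsReflectionPositiveMeasure {d : ℕ} [NeZero d] (ν : Measure C(BallSpace d, ℝ)) : Prop :=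
  ∀ Ψ : C(BallSpace d, ℝ) → ℂ, IsBoundedMeasurableOn (halfBalls d) Ψ →
    0 ≤ (∫ f, Ψ f * conj (Ψ (actFun (reflection d).symm f)) ∂ν).re ∧
      (∫ f, Ψ f * conj (Ψ (actFun (reflection d).symm f)) ∂ν).im = 0

end BallField

end

/-!
Every positive semidefinite quadratic form on `L²(ℝ^d)` is the pullback of a Hilbert norm
(`exists_linearMap_inner_eq`), and a Hilbert space carries an isonormal Gaussian process
(`exists_linearIsometry_map_eq_gaussianReal`). Composed with `b ↦ v_r 1_b`, these give a Gaussian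
field on the balls whose covariance is the kernel of `A`. The volume of a symmetric difference of
balls is locally Lipschitz in the centres and radii (`norm_ballVec_sub_sq_le`), so the increments of
this field satisfy Kolmogorov's criterion with moments of arbitrarily high order, and the field has
a version with continuous paths (`exists_isFieldMeasure`). The continuous version is a limit of
multilinear interpolations on grids of mesh `16^(-n)`
(`IsLocallyKolmogorov.exists_continuous_modification`). Only positive semidefiniteness of `A`
matters here.

Since the Borel σ-algebra of `C(X)` is generated by the evaluations, a finite measure on it is
determined by the characteristic functions of finite families of evaluations
(`measure_ext_of_integral_cexp_sum`). This yields uniqueness, and invariance follows because motions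
permute the vectors `v_r 1_b` and commute with `A`.

Reflection positivity is a conditional independence argument. Let `P` be the projection onto the
closure of the test functions of the half-space, which contains `v_r 1_b` for all balls `b` of the
half-space. The operator `K = P A θ P` is positive by hypothesis, and `P A P - K` is positive
because `2 ⟨y, (A - A θ) y⟩ = ⟨y - θ y, A (y - θ y)⟩`. So there are independent continuous
Gaussian fields `Z`, `U`, `U'` with covariance operators `K`, `P A P - K`, `P A P - K`. On the balls of the
half-space, the field and its reflection have the joint law of `Z + U` and `Z + U'`
(`map_reflectionPair_eq`), which are independent and identically distributed given `Z`. Hence the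
integral of `Ψ · conj (θ Ψ)` is the integral over `Z` of `|E[Ψ(Z + U) | Z]|²`.
-/

namespace BallField

open MeasureTheory ProbabilityTheory
open Set Filter Topology
open scoped ComplexConjugate ContDiff

universe u

/-! ### Spaces of continuous functions and their Borel σ-algebra -/

/-- A subbasic open set `{f | f(K) ⊆ U}` is described by countably many evaluations: `f(K) ⊆ U` if
and only if `f` stays at distance at least `1 / n` from `Uᶜ` on a countable dense subset of `K`, for
some `n`. -/
theorem borel_continuousMap_eq_iSup_comap_eval (X : Type*) [TopologicalSpace X]
    [SecondCountableTopology X] [LocallyCompactSpace X] :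
    (borel C(X, ℝ)) = ⨆ x : X, MeasurableSpace.comap (fun f : C(X, ℝ) => f x) inferInstance := by
  apply le_antisymm
  · rw [borel_eq_generateFrom_of_subbasis (ContinuousMap.compactOpen_eq (X := X) (Y := ℝ))]
    apply MeasurableSpace.generateFrom_le
    rintro _ ⟨K, hK, U, hU, rfl⟩
    have hK : IsCompact K := hK
    have hU : IsOpen U := hU
    obtain ⟨q, hqc, hqd⟩ := TopologicalSpace.exists_countable_dense K
    have key : {f : C(X, ℝ) | MapsTo f K U} = ⋃ n : ℕ, ⋂ x ∈ q,
        (fun f : C(X, ℝ) => f x) ⁻¹' {y | (n : ENNReal)⁻¹ ≤ Metric.infEDist y Uᶜ} := by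
      ext f
      simp only [mem_ofPred_eq, mem_iUnion, mem_iInter, mem_preimage]
      constructor
      · intro hf
        obtain ⟨δ, hδ, hδU⟩ := (hK.image f.continuous).exists_thickening_subset_open hU
          (image_subset_iff.2 hf)
        obtain ⟨n, hn⟩ := ENNReal.exists_inv_nat_lt (ENNReal.ofReal_pos.2 hδ).ne'
        refine ⟨n, fun x _ => Metric.le_infEDist.2 fun y hy => ?_⟩
        by_contra! hlt
        refine hy (hδU ((Metric.mem_thickening_iff_exists_edist_lt _ _).2
          ⟨f x, mem_image_of_mem f x.2, ?_⟩))
        rw [edist_comm]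
        exact hlt.trans hn
      · rintro ⟨n, hn⟩ x hx
        have hcl : IsClosed {x : K | (n : ENNReal)⁻¹ ≤ Metric.infEDist (f x) Uᶜ} :=
          isClosed_le continuous_const (Metric.continuous_infEDist.comp
            (f.continuous.comp continuous_subtype_val))
        have hmem : (⟨x, hx⟩ : K) ∈ {x : K | (n : ENNReal)⁻¹ ≤ Metric.infEDist (f x) Uᶜ} :=
          closure_minimal (fun y hy => hn y hy) hcl (hqd ⟨x, hx⟩)
        by_contra hxU
        have h0 := Metric.infEDist_zero_of_mem (s := Uᶜ) hxU
        simp [h0] at hmem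
    let m : MeasurableSpace C(X, ℝ) :=
      ⨆ x : X, MeasurableSpace.comap (fun f : C(X, ℝ) => f x) inferInstance
    change MeasurableSet[m] {f : C(X, ℝ) | MapsTo f K U}
    rw [key]
    refine MeasurableSet.iUnion fun n => MeasurableSet.biInter hqc fun x _ => ?_
    have hcl : MeasurableSet {y : ℝ | (n : ENNReal)⁻¹ ≤ Metric.infEDist y Uᶜ} :=
      (isClosed_le continuous_const Metric.continuous_infEDist).measurableSet
    exact le_iSup (fun x : X => MeasurableSpace.comap (fun f : C(X, ℝ) => f x) inferInstance) x _
      ⟨_, hcl, rfl⟩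
  · refine iSup_le fun x => ?_
    rw [← measurable_iff_comap_le]
    have : Continuous fun f : C(X, ℝ) => f x := ContinuousEvalConst.continuous_eval_const x
    exact this.borel_measurable

theorem measurable_of_measurable_eval {Ω X : Type*} [MeasurableSpace Ω]
    [TopologicalSpace X] [SecondCountableTopology X] [LocallyCompactSpace X] {F : Ω → C(X, ℝ)}
    (h : ∀ x, Measurable fun w => F w x) : Measurable F := by
  rw [measurable_iff_comap_le, BorelSpace.measurable_eq (α := C(X, ℝ)),
    borel_continuousMap_eq_iSup_comap_eval, MeasurableSpace.comap_iSup]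
  refine iSup_le fun x => ?_
  rw [MeasurableSpace.comap_comp]
  exact (h x).comap_le

/-! ### Characteristic functions of Gaussian fields -/

/-- Finite measures on a σ-algebra generated by real functions `e t` agree if the characteristic
functions of all finite families of the `e t` agree. -/
theorem measure_ext_of_integral_cexp_sum {S T : Type*} [mS : MeasurableSpace S]
    {μ ν : Measure S} [IsFiniteMeasure μ] [IsFiniteMeasure ν] (e : T → S → ℝ)
    (hgen : mS = ⨆ t, MeasurableSpace.comap (e t) inferInstance)
    (h : ∀ (I : Finset T) (c : T → ℝ),
      ∫ x, Complex.exp ((∑ t ∈ I, c t * e t x : ℝ) * Complex.I) ∂μ =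
        ∫ x, Complex.exp ((∑ t ∈ I, c t * e t x : ℝ) * Complex.I) ∂ν) :
    μ = ν := by
  classical
  have he : ∀ t, Measurable (e t) := fun t => by
    rw [measurable_iff_comap_le, hgen]
    exact le_iSup (fun t => MeasurableSpace.comap (e t) inferInstance) t
  set F : S → T → ℝ := fun x t => e t x with hF
  have hFm : Measurable F := measurable_pi_lambda _ he
  have hcomap : mS = MeasurableSpace.comap F MeasurableSpace.pi := by
    rw [MeasurableSpace.pi, MeasurableSpace.comap_iSup, hgen]
    simp only [MeasurableSpace.comap_comp]
    rfl
  have hfin : ∀ I : Finset T,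
      (μ.map F).map I.restrict = (ν.map F).map I.restrict := by
    intro I
    rw [Measure.map_map (Finset.measurable_restrict _) hFm,
      Measure.map_map (Finset.measurable_restrict _) hFm]
    have hm : Measurable (I.restrict ∘ F) := (Finset.measurable_restrict _).comp hFm
    refine Measure.ext_of_charFunDual ?_
    ext L
    rw [charFunDual_apply, charFunDual_apply, integral_map hm.aemeasurable (by fun_prop),
      integral_map hm.aemeasurable (by fun_prop)]
    have hL : ∀ x, L ((I.restrict ∘ F) x) = ∑ t ∈ I,
        (if ht : t ∈ I then L (Pi.single ⟨t, ht⟩ 1) else 0) * e t x := by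
      intro x
      rw [← Finset.sum_coe_sort I]
      conv_lhs => rw [← Finset.univ_sum_single ((I.restrict ∘ F) x), map_sum]
      refine Finset.sum_congr rfl fun i _ => ?_
      have : Pi.single i ((I.restrict ∘ F) x i) = e i x • (Pi.single i (1 : ℝ) : I → ℝ) := by
        ext j
        by_cases hj : j = i
        · subst hj; simp [F]
        · simp [hj]
      rw [this, map_smul]
      simp [mul_comm]
    simp only [hL]
    exact h I fun t => if ht : t ∈ I then L (Pi.single ⟨t, ht⟩ 1) else 0
  have hmap : μ.map F = ν.map F := by
    refine IsProjectiveLimit.unique (P := fun I => (ν.map F).map I.restrict) hfin fun I => rfl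
  ext s hs
  rw [hcomap] at hs
  obtain ⟨s', hs', rfl⟩ := hs
  rw [← Measure.map_apply hFm hs', hmap, Measure.map_apply hFm hs']

/-- The characteristic function of a centred Gaussian field. The points `b i` need not be distinct,
which allows coefficients to be split over several index sets. -/
theorem IsCenteredGaussianField.integral_cexp_sum {T Ω ι : Type*} [MeasurableSpace Ω]
    {X : T → Ω → ℝ} {C : T → T → ℝ} {P : Measure Ω} (h : IsCenteredGaussianField X C P)
    (I : Finset ι) (b : ι → T) (c : ι → ℝ) :
    ∫ w, Complex.exp ((∑ i ∈ I, c i * X (b i) w : ℝ) * Complex.I) ∂P =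
      Complex.exp (-((∑ i ∈ I, ∑ j ∈ I, c i * c j * C (b i) (b j) : ℝ) : ℂ) / 2) := by
  obtain ⟨_, hgauss, hmean_zero, hcov⟩ := h
  have hg : HasGaussianLaw (fun w => ∑ i ∈ I, c i * X (b i) w) P :=
    ((hgauss.comp_right b).smul c).hasGaussianLaw_fun_sum
  have hX : ∀ t, MemLp (X t) 2 P := fun t => (hgauss.hasGaussianLaw_eval t).memLp_two
  have hmean : ∫ w, ∑ i ∈ I, c i * X (b i) w ∂P = 0 := by
    rw [integral_finsetSum _ fun i _ => ((hX _).integrable (by norm_num)).const_mul _]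
    simp [integral_const_mul, hmean_zero]
  have hvar : Var[fun w => ∑ i ∈ I, c i * X (b i) w; P] =
      ∑ i ∈ I, ∑ j ∈ I, c i * c j * C (b i) (b j) := by
    rw [variance_of_integral_eq_zero hg.aemeasurable hmean]
    have : ∀ w, (∑ i ∈ I, c i * X (b i) w) ^ 2 =
        ∑ i ∈ I, ∑ j ∈ I, c i * c j * (X (b i) w * X (b j) w) := fun w => by
      rw [sq, Finset.sum_mul_sum]
      exact Finset.sum_congr rfl fun i _ => Finset.sum_congr rfl fun j _ => by ring
    simp only [this]
    have hint : ∀ i j, Integrable (fun w => c i * c j * (X (b i) w * X (b j) w)) P :=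
      fun i j => ((hX _).integrable_mul (hX _)).const_mul _
    rw [integral_finsetSum _ fun i _ => integrable_finsetSum _ fun j _ => hint i j]
    refine Finset.sum_congr rfl fun i _ => ?_
    rw [integral_finsetSum _ fun j _ => hint i j]
    exact Finset.sum_congr rfl fun j _ => by rw [integral_const_mul, hcov]
  have h1 := charFun_gaussianReal (μ := 0)
    (v := (∑ i ∈ I, ∑ j ∈ I, c i * c j * C (b i) (b j)).toNNReal) 1
  rw [← hvar, ← hmean, ← hg.map_eq_gaussianReal, charFun_apply_real,
    integral_map hg.aemeasurable (by fun_prop), hmean, hvar,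
    Real.coe_toNNReal _ (hvar ▸ variance_nonneg _ _)] at h1
  rw [neg_div]
  simpa using h1

/-! ### The isonormal Gaussian process of a Hilbert space -/

/-- A positive semidefinite form is the pullback of the inner product of a Hilbert space, the
completion of `V` for the seminorm defined by the form. -/
theorem exists_linearMap_inner_eq {V : Type u} [AddCommGroup V] [Module ℝ V]
    (B : LinearMap.BilinForm ℝ V) (hs : ∀ x y, B x y = B y x) (hp : ∀ x, 0 ≤ B x x) :
    ∃ (H : Type u) (_ : NormedAddCommGroup H) (_ : InnerProductSpace ℝ H) (_ : CompleteSpace H)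
      (j : V →ₗ[ℝ] H), ∀ x y, inner ℝ (j x) (j y) = B x y := by
  let core : PreInnerProductSpace.Core ℝ V :=
    { inner := fun x y => B x y
      conj_inner_symm := fun x y => hs y x
      re_inner_nonneg := hp
      add_left := fun x y z => by simp
      smul_left := fun x y r => by simp }
  let _ : SeminormedAddCommGroup V := InnerProductSpace.Core.toSeminormedAddCommGroup (𝕜 := ℝ)
  let _ : InnerProductSpace ℝ V := .ofCore _
  exact ⟨UniformSpace.Completion V, inferInstance, inferInstance, inferInstance,
    (UniformSpace.Completion.toComplL (𝕜 := ℝ) (E := V)).toLinearMap, fun x y => by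
      exact UniformSpace.Completion.inner_coe x y⟩

/-- The value at `1` of the characteristic function is a `1`-Lipschitz function of the random
variable in `L²`. -/
theorem norm_integral_cexp_sub_le {Ω : Type*} [MeasurableSpace Ω] {P : Measure Ω}
    [IsProbabilityMeasure P] (f g : Lp ℝ 2 P) :
    ‖∫ w, Complex.exp ((f w : ℂ) * Complex.I) ∂P - ∫ w, Complex.exp ((g w : ℂ) * Complex.I) ∂P‖ ≤
      ‖f - g‖ := by
  have hint : ∀ f : Lp ℝ 2 P, Integrable (fun w => Complex.exp ((f w : ℂ) * Complex.I)) P := by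
    intro f
    refine Integrable.of_bound (C := 1) ?_ ?_
    · have := (Lp.aestronglyMeasurable f).aemeasurable
      exact AEMeasurable.aestronglyMeasurable (by fun_prop)
    · simp [Complex.norm_exp_ofReal_mul_I]
  rw [← integral_sub (hint f) (hint g)]
  calc ‖∫ w, (Complex.exp ((f w : ℂ) * Complex.I) - Complex.exp ((g w : ℂ) * Complex.I)) ∂P‖
      ≤ ∫ w, ‖(f - g : Lp ℝ 2 P) w‖ ∂P := by
        refine norm_integral_le_of_norm_le ((Lp.memLp (f - g)).integrable (by norm_num)).norm ?_
        filter_upwards [Lp.coeFn_sub f g] with w hw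
        rw [hw, Pi.sub_apply]
        have h1 : Complex.exp ((f w : ℂ) * Complex.I) - Complex.exp ((g w : ℂ) * Complex.I) =
            Complex.exp ((g w : ℂ) * Complex.I) *
              (Complex.exp (Complex.I * ((f w - g w : ℝ) : ℂ)) - 1) := by
          rw [mul_sub, ← Complex.exp_add, mul_one]
          congr 2
          push_cast
          ring
        rw [h1, norm_mul, Complex.norm_exp_ofReal_mul_I, one_mul]
        exact Real.norm_exp_I_mul_ofReal_sub_one_le
    _ ≤ ‖f - g‖ := by
        rw [integral_norm_eq_lintegral_enorm (Lp.aestronglyMeasurable _),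
          ← eLpNorm_one_eq_lintegral_enorm, Lp.norm_def]
        exact ENNReal.toReal_mono (Lp.eLpNorm_ne_top _)
          (eLpNorm_le_eLpNorm_of_exponent_le (by norm_num) (Lp.aestronglyMeasurable _))

theorem memLp_eval_infinitePi_gaussianReal {ι : Type*} (i : ι) :
    MemLp (fun x : ι → ℝ => x i) 2 (Measure.infinitePi fun _ => gaussianReal 0 1) :=
  (memLp_id_gaussianReal' 2 (by norm_num)).comp_measurePreserving
    (measurePreserving_eval_infinitePi (fun _ : ι => gaussianReal 0 1) i)

/-- The coordinate `x ↦ x i` of a family of independent standard Gaussian variables, as a vector of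
`L²`. -/
noncomputable def gaussianCoord {ι : Type*} (i : ι) :
    Lp ℝ 2 (Measure.infinitePi fun _ : ι => gaussianReal 0 1) :=
  (memLp_eval_infinitePi_gaussianReal i).toLp

theorem coeFn_gaussianCoord {ι : Type*} (i : ι) :
    gaussianCoord i =ᵐ[Measure.infinitePi fun _ : ι => gaussianReal 0 1] fun x => x i :=
  (memLp_eval_infinitePi_gaussianReal i).coeFn_toLp

theorem orthonormal_gaussianCoord (ι : Type*) :
    Orthonormal ℝ fun i : ι => gaussianCoord i := by
  classical
  rw [orthonormal_iff_ite]
  intro i j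
  rw [L2.inner_def]
  have h1 : ∫ x : ι → ℝ, inner ℝ (gaussianCoord i x)
      (gaussianCoord j x)
        ∂(Measure.infinitePi fun _ => gaussianReal 0 1) =
      ∫ x : ι → ℝ, x i * x j ∂(Measure.infinitePi fun _ => gaussianReal 0 1) := by
    refine integral_congr_ae ?_
    filter_upwards [coeFn_gaussianCoord i,
      coeFn_gaussianCoord j] with x hi hj
    rw [hi, hj]
    simp [mul_comm]
  rw [h1]
  have hmp := fun i : ι => measurePreserving_eval_infinitePi (fun _ : ι => gaussianReal 0 1) i
  split_ifs with hij
  · subst hij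
    have h2 := variance_fun_id_gaussianReal (μ := 0) (v := 1)
    rw [variance_of_integral_eq_zero aemeasurable_id' (by simp),
      ← (hmp i).map_eq, integral_map (hmp i).measurable.aemeasurable (by fun_prop)] at h2
    simpa [sq] using h2
  · have hind := (iIndepFun_infinitePi (P := fun _ : ι => gaussianReal 0 1)
      (X := fun _ x => x) fun _ => measurable_id).indepFun hij
    have := hind.integral_fun_mul_eq_mul_integral
      (measurable_pi_apply i).aestronglyMeasurable (measurable_pi_apply j).aestronglyMeasurable
    rw [this]
    have h0 : ∫ x : ι → ℝ, x i ∂(Measure.infinitePi fun _ => gaussianReal 0 1) = 0 := by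
      have := integral_id_gaussianReal (μ := 0) (v := 1)
      rwa [← (hmp i).map_eq, integral_map (hmp i).measurable.aemeasurable (by fun_prop)] at this
    rw [h0, zero_mul]

/-- The isonormal process of a Hilbert space: an isometry into an `L²` space of random variables
that takes each vector to a centred Gaussian variable. It sends a Hilbert basis to independent
standard Gaussian variables; Gaussianity passes from finite combinations to their `L²` limits. -/
theorem exists_linearIsometry_map_eq_gaussianReal (H : Type u) [NormedAddCommGroup H]
    [InnerProductSpace ℝ H] [CompleteSpace H] :
    ∃ (Ω : Type u) (_ : MeasurableSpace Ω) (P : Measure Ω) (_ : IsProbabilityMeasure P)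
      (W : H →ₗᵢ[ℝ] Lp ℝ 2 P), ∀ h, P.map (W h) = gaussianReal 0 (‖h‖ ^ 2).toNNReal := by
  classical
  obtain ⟨ι, b, -⟩ := exists_hilbertBasis ℝ H
  set P : Measure (ι → ℝ) := Measure.infinitePi fun _ => gaussianReal 0 1 with hP
  -- The isometry that sends the basis vector `b i` to the `i`-th coordinate function.
  have hortho := orthonormal_gaussianCoord ι
  set W : H →ₗᵢ[ℝ] Lp ℝ 2 P :=
    hortho.orthogonalFamily.linearIsometry.comp b.repr.toLinearIsometry with hW
  have hWb : ∀ i, W (b i) = gaussianCoord i := by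
    intro i
    change hortho.orthogonalFamily.linearIsometry (b.repr (b i)) = _
    rw [b.repr_self]
    refine (hortho.orthogonalFamily.linearIsometry_apply_single (1 : ℝ)).trans ?_
    exact one_smul ℝ (gaussianCoord i)
  have key : ∀ h, ∫ w, Complex.exp ((W h w : ℂ) * Complex.I) ∂P =
      Complex.exp (-((‖h‖ ^ 2 : ℝ) : ℂ) / 2) := by
    -- Both sides are continuous in `h`, so it suffices to treat finite combinations of the basis.
    have hclosed : IsClosed {h | ∫ w, Complex.exp ((W h w : ℂ) * Complex.I) ∂P =
      Complex.exp (-((‖h‖ ^ 2 : ℝ) : ℂ) / 2)} := by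
      refine isClosed_eq ?_ (by fun_prop)
      refine LipschitzWith.continuous (K := 1) (LipschitzWith.of_dist_le_mul fun x y => ?_)
      rw [dist_eq_norm, dist_eq_norm, NNReal.coe_one, one_mul, ← W.norm_map (x - y), map_sub]
      exact norm_integral_cexp_sub_le _ _
    have hsub : ((Submodule.span ℝ (range b) : Submodule ℝ H) : Set H) ⊆
        {h | ∫ w, Complex.exp ((W h w : ℂ) * Complex.I) ∂P =
          Complex.exp (-((‖h‖ ^ 2 : ℝ) : ℂ) / 2)} := by
      intro h hh
      obtain ⟨c, rfl⟩ := (Finsupp.mem_span_range_iff_exists_finsupp).1 hh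
      have h1 : ∀ᵐ w ∂P, W (c.sum fun i a => a • b i) w = ∑ i ∈ c.support, c i * w i := by
        have h2 : W (c.sum fun i a => a • b i) =
            ∑ i ∈ c.support, c i • gaussianCoord i := by
          simp [Finsupp.sum, hWb]
        rw [h2]
        have h3 : ∀ᵐ w ∂P, ∀ i ∈ c.support,
            (c i • gaussianCoord i : Lp ℝ 2 P) w = c i * w i := by
          refine (Finset.eventually_all _).2 fun i _ => ?_
          filter_upwards [Lp.coeFn_smul (c i) (gaussianCoord i),
            coeFn_gaussianCoord i] with w h4 h5
          rw [h4, Pi.smul_apply, h5, smul_eq_mul]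
        filter_upwards [h3, Lp.coeFn_finsetSum c.support
          fun i => (c i • gaussianCoord i : Lp ℝ 2 P)] with w h4 h5
        rw [h5, Finset.sum_apply]
        exact Finset.sum_congr rfl h4
      have hnorm : ‖c.sum fun i a => a • b i‖ ^ 2 = ∑ i ∈ c.support, c i ^ 2 := by
        rw [← real_inner_self_eq_norm_sq]
        simp only [Finsupp.sum]
        rw [b.orthonormal.inner_sum]
        simp [sq]
      rw [mem_ofPred_eq, hnorm]
      calc ∫ w, Complex.exp ((W (c.sum fun i a => a • b i) w : ℂ) * Complex.I) ∂P
          = ∫ w : ι → ℝ, (fun y : c.support → ℝ => 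
                ∏ i : c.support, Complex.exp ((c i * y i : ℂ) * Complex.I))
              (c.support.restrict w) ∂P := by
            refine integral_congr_ae ?_
            filter_upwards [h1] with w hw
            rw [hw, ← Finset.sum_coe_sort, ← Complex.exp_sum, ← Finset.sum_mul]
            simp
        _ = ∏ i : c.support, ∫ x, Complex.exp ((c i * x : ℂ) * Complex.I) ∂(gaussianReal 0 1) := by
            refine (integral_restrict_infinitePi (fun _ : ι => gaussianReal 0 1)
              (f := fun y : c.support → ℝ =>
                ∏ i : c.support, Complex.exp ((c i * y i : ℂ) * Complex.I))
              (Continuous.aestronglyMeasurable (by fun_prop))).trans ?_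
            exact integral_fintype_prod_eq_prod
              (fun (i : c.support) (x : ℝ) => Complex.exp ((c i * x : ℂ) * Complex.I))
        _ = ∏ i : c.support, Complex.exp (-(c i ^ 2 : ℂ) / 2) := by
            refine Finset.prod_congr rfl fun i _ => ?_
            rw [← charFun_apply_real, charFun_gaussianReal]
            simp [neg_div]
        _ = _ := by
            rw [← Complex.exp_sum, Finset.sum_coe_sort c.support fun i => -(c i ^ 2 : ℂ) / 2]
            push_cast
            rw [← Finset.sum_div, Finset.sum_neg_distrib]
    intro h
    have : h ∈ (Submodule.span ℝ (range b)).topologicalClosure := by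
      rw [b.dense_span]; trivial
    exact closure_minimal hsub hclosed this
  refine ⟨ι → ℝ, inferInstance, P, inferInstance, W, fun h => ?_⟩
  have hm : AEMeasurable (W h) P := (Lp.aestronglyMeasurable _).aemeasurable
  have := Measure.isProbabilityMeasure_map hm
  refine Measure.ext_of_charFun ?_
  ext t
  rw [charFun_apply_real, integral_map hm (by fun_prop), charFun_gaussianReal,
    Real.coe_toNNReal _ (sq_nonneg _)]
  have h1 := key (t • h)
  rw [norm_smul, mul_pow] at h1
  have h2 : ∫ w, Complex.exp (t * (W h w : ℂ) * Complex.I) ∂P =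
      ∫ w, Complex.exp ((W (t • h) w : ℂ) * Complex.I) ∂P := by
    refine integral_congr_ae ?_
    rw [map_smul]
    filter_upwards [Lp.coeFn_smul t (W h)] with w hw
    rw [hw]
    simp
  rw [h2, h1]
  congr 1
  simp
  ring

/-! ### Kolmogorov's continuity criterion by multilinear interpolation -/

/-- The piecewise linear hat function with peak `1` at `0` and support `[-1, 1]`. -/
noncomputable def hat (x : ℝ) : ℝ := max 0 (1 - |x|)

theorem continuous_hat : Continuous hat := by unfold hat; fun_prop

theorem hat_nonneg (x : ℝ) : 0 ≤ hat x := le_max_left _ _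

theorem abs_le_one_of_hat_ne_zero {x : ℝ} (h : hat x ≠ 0) : |x| ≤ 1 := by
  by_contra! h1
  exact h (max_eq_left (by linarith))

theorem sum_hat_sub_intCast {M : ℤ} {x : ℝ} (h1 : -(M : ℝ) ≤ x) (h2 : x < M) :
    ∑ k ∈ Finset.Icc (-M) M, hat (x - k) = 1 := by
  have hf : (⌊x⌋ : ℝ) ≤ x := Int.floor_le x
  have hf' : x < ⌊x⌋ + 1 := Int.lt_floor_add_one x
  have hlo : -M ≤ ⌊x⌋ := Int.le_floor.2 (by push_cast; exact h1)
  have hhi : ⌊x⌋ < M := Int.floor_lt.2 h2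
  rw [← Finset.sum_subset (s₁ := {⌊x⌋, ⌊x⌋ + 1})]
  · rw [Finset.sum_pair (by omega)]
    have e1 : hat (x - ⌊x⌋) = 1 - (x - ⌊x⌋) := by
      rw [hat, abs_of_nonneg (by linarith), max_eq_right (by linarith)]
    have e2 : hat (x - (⌊x⌋ + 1 : ℤ)) = 1 + (x - (⌊x⌋ + 1)) := by
      push_cast
      rw [hat, abs_of_nonpos (by linarith), max_eq_right (by linarith)]
      ring
    rw [e1, e2]
    ring
  · intro k hk
    simp only [Finset.mem_insert, Finset.mem_singleton] at hk
    rw [Finset.mem_Icc]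
    omega
  · intro k _ hk
    simp only [Finset.mem_insert, Finset.mem_singleton, not_or] at hk
    refine max_eq_left ?_
    rcases lt_or_ge k ⌊x⌋ with h | h
    · have : (k : ℝ) + 1 ≤ ⌊x⌋ := by exact_mod_cast h
      rw [abs_of_nonneg (by linarith)]
      linarith
    · have : (⌊x⌋ : ℝ) + 1 + 1 ≤ k := by
        have : ⌊x⌋ + 1 + 1 ≤ k := by omega
        exact_mod_cast this
      rw [abs_of_nonpos (by linarith)]
      linarith

/-- The integer points of the box `[-256^n, 256^n]^D`. They index the points of the grid of mesh
`16^(-n)` in the box `[-16^n, 16^n]^D`, so that the boxes exhaust the space. -/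
noncomputable def gridIndex (D n : ℕ) : Finset (Fin D → ℤ) :=
  Fintype.piFinset fun _ => Finset.Icc (-(256 ^ n)) (256 ^ n)

/-- The point of the grid of mesh `16^(-n)` with integer coordinates `k`. -/
noncomputable def gridPoint {D : ℕ} (n : ℕ) (k : Fin D → ℤ) : Fin D → ℝ := fun i => k i / 16 ^ n

/-- The multilinear bump function of mesh `16^(-n)` around `gridPoint n k`. For `k` in
`gridIndex D n` these form a partition of unity on the open box of radius `16^n`. -/
noncomputable def gridBump {D : ℕ} (n : ℕ) (k : Fin D → ℤ) : C(Fin D → ℝ, ℝ) where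
  toFun t := ∏ i, hat (16 ^ n * t i - k i)
  continuous_toFun := continuous_finsetProd _ fun i _ => continuous_hat.comp (by fun_prop)

theorem gridBump_apply {D : ℕ} (n : ℕ) (k : Fin D → ℤ) (t : Fin D → ℝ) :
    gridBump n k t = ∏ i, hat (16 ^ n * t i - k i) := rfl

theorem card_gridIndex_le (D n : ℕ) : (gridIndex D n).card ≤ 3 ^ D * 256 ^ (D * n) := by
  rw [gridIndex, Fintype.card_piFinset_const, Int.card_Icc, Nat.mul_comm D n, pow_mul, ← mul_pow]
  refine Nat.pow_le_pow_left ?_ _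
  have : (1 : ℤ) ≤ 256 ^ n := one_le_pow₀ (by norm_num)
  zify
  rw [Int.toNat_of_nonneg (by linarith)]
  linarith

theorem gridBump_nonneg {D : ℕ} (n : ℕ) (k : Fin D → ℤ) (t : Fin D → ℝ) :
    0 ≤ gridBump n k t := by
  rw [gridBump_apply]
  exact Finset.prod_nonneg fun _ _ => hat_nonneg _

theorem sum_gridBump {D : ℕ} {n : ℕ} {t : Fin D → ℝ} (ht : ‖t‖ < 16 ^ n) :
    ∑ k ∈ gridIndex D n, gridBump n k t = 1 := by
  simp only [gridBump, ContinuousMap.coe_mk, gridIndex]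
  rw [← Finset.prod_univ_sum (fun _ : Fin D => Finset.Icc (-(256 ^ n : ℤ)) (256 ^ n))
    fun i k => hat (16 ^ n * t i - k)]
  refine Finset.prod_eq_one fun i _ => ?_
  have h1 := (norm_le_pi_norm t i).trans_lt ht
  rw [Real.norm_eq_abs, abs_lt] at h1
  have h3 : (256 : ℝ) ^ n = 16 ^ n * 16 ^ n := by rw [← mul_pow]; norm_num
  have h4 : (0 : ℝ) < 16 ^ n := by positivity
  apply sum_hat_sub_intCast
  · push_cast
    rw [h3]
    nlinarith
  · push_cast
    rw [h3]
    exact mul_lt_mul_of_pos_left h1.2 h4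

theorem norm_gridPoint_sub_le {D : ℕ} {n : ℕ} {k : Fin D → ℤ} {t : Fin D → ℝ}
    (h : gridBump n k t ≠ 0) : ‖gridPoint n k - t‖ ≤ 1 / 16 ^ n := by
  rw [gridBump_apply] at h
  refine (pi_norm_le_iff_of_nonneg (by positivity)).2 fun i => ?_
  have h1 := abs_le_one_of_hat_ne_zero (Finset.prod_ne_zero_iff.1 h i (Finset.mem_univ i))
  have h4 : (0 : ℝ) < 16 ^ n := by positivity
  rw [Pi.sub_apply, gridPoint, Real.norm_eq_abs, le_div_iff₀ h4, ← abs_of_pos h4, ← abs_mul,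
    abs_of_pos h4]
  rw [abs_sub_comm] at h1
  rwa [sub_mul, div_mul_cancel₀ _ h4.ne', mul_comm (t i)]

/-- A convex combination is as close to `y` as the values that enter it with nonzero weight. -/
theorem abs_sum_mul_sub_le {ι : Type*} {I : Finset ι} {φ x : ι → ℝ} {y B : ℝ}
    (hφ : ∀ i ∈ I, 0 ≤ φ i) (hsum : ∑ i ∈ I, φ i = 1)
    (h : ∀ i ∈ I, φ i ≠ 0 → |x i - y| ≤ B) : |∑ i ∈ I, φ i * x i - y| ≤ B := by
  have h1 : ∑ i ∈ I, φ i * x i - y = ∑ i ∈ I, φ i * (x i - y) := by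
    simp only [mul_sub, Finset.sum_sub_distrib]
    rw [← Finset.sum_mul, hsum, one_mul]
  calc |∑ i ∈ I, φ i * x i - y| ≤ ∑ i ∈ I, |φ i * (x i - y)| :=
        h1 ▸ Finset.abs_sum_le_sum_abs _ _
    _ ≤ ∑ i ∈ I, φ i * B := by
        refine Finset.sum_le_sum fun i hi => ?_
        by_cases h0 : φ i = 0
        · simp [h0]
        · rw [abs_mul, abs_of_nonneg (hφ i hi)]
          exact mul_le_mul_of_nonneg_left (h i hi h0) (hφ i hi)
    _ = B := by rw [← Finset.sum_mul, hsum, one_mul]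

/-- Either `|a| ≤ A⁻¹`, or `1 ≤ (A |a|)^m`. With `A = 2^n` this trades a summable error for a high
moment of `a`. -/
theorem abs_le_inv_add_pow_mul {A a : ℝ} (hA : 0 < A) (m : ℕ) :
    |a| ≤ A⁻¹ + A ^ m * |a| ^ (m + 1) := by
  rcases le_or_gt |a| A⁻¹ with h | h
  · have : 0 ≤ A ^ m * |a| ^ (m + 1) := by positivity
    linarith
  · have h1 : 1 ≤ A * |a| := by
      have := mul_le_mul_of_nonneg_left h.le hA.le
      rwa [mul_inv_cancel₀ hA.ne'] at this
    have h2 : A ^ m * |a| ^ (m + 1) = (A * |a|) ^ m * |a| := by ring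
    have h3 : 1 * |a| ≤ (A * |a|) ^ m * |a| :=
      mul_le_mul_of_nonneg_right (one_le_pow₀ h1) (abs_nonneg a)
    have : 0 < A⁻¹ := inv_pos.2 hA
    linarith

/-- Kolmogorov's moment condition, locally uniformly on `ℝ^D`, with the exponents that a field with
increments of variance `O(‖s - t‖)` satisfies: the moment of order `2 p` of `X s - X t` is
`O(‖s - t‖^p)`, where `p = 8 D + 1`. -/
def IsLocallyKolmogorov {D : ℕ} {Ω : Type*} [MeasurableSpace Ω] (X : (Fin D → ℝ) → Ω → ℝ)
    (P : Measure Ω) : Prop :=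
  ∀ R : ℝ, ∃ C : ℝ, 0 ≤ C ∧ ∀ s t : Fin D → ℝ, ‖s‖ ≤ R → ‖t‖ ≤ R →
    ∫⁻ w, ENNReal.ofReal (|X s w - X t w| ^ (16 * D + 2)) ∂P ≤
      ENNReal.ofReal (C * ‖s - t‖ ^ (8 * D + 1))

/-- The number of increments at level `n` is at most `c 4^(8 D n)`, each has a moment of order `2 p`
of size `O(16^(-n p))`, and the factor in front is below `4^(n p)`. With `p = 8 D + 1` the
expectations are `O(4^(-n))`. -/
theorem IsLocallyKolmogorov.ae_summable {D : ℕ} {Ω : Type*} [MeasurableSpace Ω]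
    {X : (Fin D → ℝ) → Ω → ℝ} {P : Measure Ω} (hX : ∀ t, Measurable (X t))
    (h : IsLocallyKolmogorov X P) (R : ℝ) (c : ℝ) (Q : ℕ → Finset ((Fin D → ℝ) × (Fin D → ℝ)))
    (hQ : ∀ n, ∀ q ∈ Q n, ‖q.1‖ ≤ R ∧ ‖q.2‖ ≤ R ∧ ‖q.1 - q.2‖ ≤ 2 / 16 ^ n)
    (hcard : ∀ n, ((Q n).card : ℝ) ≤ c * 65536 ^ (D * n)) :
    ∀ᵐ w ∂P, Summable fun n => (2 ^ n : ℝ) ^ (16 * D + 1) *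
      ∑ q ∈ Q n, |X q.1 w - X q.2 w| ^ (16 * D + 2) := by
  obtain ⟨C, hC, hbound⟩ := h R
  set f : ℕ → Ω → ℝ := fun n w => (2 ^ n : ℝ) ^ (16 * D + 1) *
      ∑ q ∈ Q n, |X q.1 w - X q.2 w| ^ (16 * D + 2) with hf
  have hf0 : ∀ n w, 0 ≤ f n w := fun n w => by positivity
  have hfm : ∀ n, Measurable (f n) := fun n => by
    refine Measurable.const_mul (Finset.measurable_fun_sum _ fun q _ => ?_) _
    exact ((hX q.1).sub (hX q.2)).abs.pow_const _
  have hle : ∀ n, ∫⁻ w, ENNReal.ofReal (f n w) ∂P ≤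
      ENNReal.ofReal (c * C * 2 ^ (8 * D + 1) * (1 / 4) ^ n) := by
    intro n
    have hint : ∀ w, ENNReal.ofReal (f n w) = ENNReal.ofReal ((2 ^ n : ℝ) ^ (16 * D + 1)) *
        ∑ q ∈ Q n, ENNReal.ofReal (|X q.1 w - X q.2 w| ^ (16 * D + 2)) := fun w => by
      rw [hf, ENNReal.ofReal_mul (by positivity), ENNReal.ofReal_sum_of_nonneg
        fun q _ => by positivity]
    simp only [hint]
    have hmq : ∀ q : (Fin D → ℝ) × (Fin D → ℝ),
        Measurable fun w => ENNReal.ofReal (|X q.1 w - X q.2 w| ^ (16 * D + 2)) := fun q =>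
      (((hX q.1).sub (hX q.2)).abs.pow_const _).ennreal_ofReal
    rw [lintegral_const_mul _ (Finset.measurable_fun_sum _ fun q _ => hmq q),
      lintegral_finsetSum _ fun q _ => hmq q]
    calc _ ≤ ENNReal.ofReal ((2 ^ n : ℝ) ^ (16 * D + 1)) *
          ∑ q ∈ Q n, ENNReal.ofReal (C * (2 / 16 ^ n) ^ (8 * D + 1)) := by
          gcongr with q hq
          obtain ⟨h1, h2, h3⟩ := hQ n q hq
          refine (hbound _ _ h1 h2).trans (ENNReal.ofReal_le_ofReal ?_)
          gcongr
      _ = ENNReal.ofReal ((2 ^ n : ℝ) ^ (16 * D + 1) *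
          ((Q n).card * (C * (2 / 16 ^ n) ^ (8 * D + 1)))) := by
          rw [Finset.sum_const, nsmul_eq_mul, ← ENNReal.ofReal_natCast (Q n).card,
            ← ENNReal.ofReal_mul (by positivity), ← ENNReal.ofReal_mul (by positivity)]
      _ ≤ _ := by
          refine ENNReal.ofReal_le_ofReal ?_
          calc (2 ^ n : ℝ) ^ (16 * D + 1) * ((Q n).card * (C * (2 / 16 ^ n) ^ (8 * D + 1)))
              ≤ (2 ^ n : ℝ) ^ (16 * D + 2) *
                ((c * 65536 ^ (D * n)) * (C * (2 / 16 ^ n) ^ (8 * D + 1))) := by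
                gcongr
                · exact one_le_pow₀ (by norm_num)
                · norm_num
                · exact hcard n
            _ = c * C * 2 ^ (8 * D + 1) * ((2 ^ n : ℝ) ^ (16 * D + 2) * 65536 ^ (D * n) /
                  (16 ^ n) ^ (8 * D + 1)) := by
                rw [div_pow]; ring
            _ = c * C * 2 ^ (8 * D + 1) * (1 / 4) ^ n := by
                congr 1
                rw [one_div, inv_pow, div_eq_iff (by positivity), eq_comm, inv_mul_eq_iff_eq_mul₀
                  (by positivity)]
                rw [show (65536 : ℝ) = 2 ^ 16 by norm_num, show (16 : ℝ) = 2 ^ 4 by norm_num,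
                  show (4 : ℝ) = 2 ^ 2 by norm_num]
                simp only [← pow_mul, ← pow_add]
                congr 1
                ring
  have hfin : ∫⁻ w, ∑' n, ENNReal.ofReal (f n w) ∂P ≠ ⊤ := by
    rw [lintegral_tsum fun n => (hfm n).ennreal_ofReal.aemeasurable]
    refine ne_top_of_le_ne_top ?_ (ENNReal.tsum_le_tsum hle)
    exact (Summable.mul_left _ (summable_geometric_of_lt_one (by norm_num)
      (by norm_num))).tsum_ofReal_ne_top
  filter_upwards [ae_lt_top (Measurable.tsum fun n => (hfm n).ennreal_ofReal) hfin]
    with w hw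
  have := ENNReal.summable_toReal hw.ne
  simpa only [ENNReal.toReal_ofReal (hf0 _ _)] using this

/-- The multilinear interpolation of the field `X` on the grid of mesh `16^(-n)`. -/
noncomputable def gridInterp {D : ℕ} {Ω : Type*} (X : (Fin D → ℝ) → Ω → ℝ) (n : ℕ) (w : Ω) :
    C(Fin D → ℝ, ℝ) :=
  ∑ k ∈ gridIndex D n, X (gridPoint n k) w • gridBump n k

theorem gridInterp_apply {D : ℕ} {Ω : Type*} (X : (Fin D → ℝ) → Ω → ℝ) (n : ℕ) (w : Ω)
    (t : Fin D → ℝ) :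
    gridInterp X n w t = ∑ k ∈ gridIndex D n, gridBump n k t * X (gridPoint n k) w := by
  rw [gridInterp, ContinuousMap.sum_apply]
  exact Finset.sum_congr rfl fun k _ => by simp [mul_comm]

theorem measurable_gridInterp {D : ℕ} {Ω : Type*} [MeasurableSpace Ω] {X : (Fin D → ℝ) → Ω → ℝ}
    (hX : ∀ t, Measurable (X t)) (n : ℕ) : Measurable (gridInterp X n) := by
  refine measurable_of_measurable_eval fun t => ?_
  simp only [gridInterp_apply]
  exact Finset.measurable_fun_sum _ fun k _ => (hX _).const_mul _

theorem IsLocallyKolmogorov.ae_tendsto_gridInterp {D : ℕ} {Ω : Type*} [MeasurableSpace Ω]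
    {X : (Fin D → ℝ) → Ω → ℝ} {P : Measure Ω} (hX : ∀ t, Measurable (X t))
    (h : IsLocallyKolmogorov X P) (t : Fin D → ℝ) :
    ∀ᵐ w ∂P, Tendsto (fun n => gridInterp X n w t) atTop (𝓝 (X t w)) := by
  classical
  have hsum := h.ae_summable hX (‖t‖ + 1) (3 ^ D)
    (fun n => ((gridIndex D n).filter fun k => ‖gridPoint n k - t‖ ≤ 1 / 16 ^ n).image
      fun k => (gridPoint n k, t)) ?_ ?_
  · filter_upwards [hsum] with w hw
    have h2 : Summable fun n : ℕ => ((2 : ℝ) ^ n)⁻¹ := by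
      simpa using summable_geometric_of_lt_one (r := (2 : ℝ)⁻¹) (by norm_num) (by norm_num)
    have h0 := (h2.add hw).tendsto_atTop_zero
    rw [tendsto_iff_dist_tendsto_zero]
    refine squeeze_zero' (Eventually.of_forall fun _ => dist_nonneg) ?_ h0
    obtain ⟨N, hN⟩ := pow_unbounded_of_one_lt ‖t‖ (by norm_num : (1 : ℝ) < 16)
    filter_upwards [eventually_ge_atTop N] with n hn
    have ht : ‖t‖ < 16 ^ n := hN.trans_le (pow_le_pow_right₀ (by norm_num) hn)
    rw [Real.dist_eq, gridInterp_apply]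
    refine abs_sum_mul_sub_le (fun k _ => gridBump_nonneg n k t) (sum_gridBump ht)
      fun k hk hk0 => ?_
    refine (abs_le_inv_add_pow_mul (A := 2 ^ n) (by positivity) (16 * D + 1)).trans ?_
    gcongr
    refine Finset.single_le_sum (f := fun q : (Fin D → ℝ) × (Fin D → ℝ) =>
      |X q.1 w - X q.2 w| ^ (16 * D + 2)) (fun q _ => by positivity)
      (a := (gridPoint n k, t)) (Finset.mem_image.2 ⟨k, ?_, rfl⟩)
    exact Finset.mem_filter.2 ⟨hk, norm_gridPoint_sub_le hk0⟩
  · intro n q hq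
    obtain ⟨k, hk, rfl⟩ := Finset.mem_image.1 hq
    have h1 := (Finset.mem_filter.1 hk).2
    have h2 : (1 : ℝ) / 16 ^ n ≤ 1 := by
      rw [div_le_one (by positivity)]; exact one_le_pow₀ (by norm_num)
    refine ⟨?_, by simp, h1.trans (by gcongr; norm_num)⟩
    have := norm_add_le (gridPoint n k - t) t
    rw [sub_add_cancel] at this
    simp only
    linarith
  · intro n
    have h1 : (((gridIndex D n).filter fun k => ‖gridPoint n k - t‖ ≤ 1 / 16 ^ n).image
      fun k => (gridPoint n k, t)).card ≤ 3 ^ D * 256 ^ (D * n) :=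
      Finset.card_image_le.trans ((Finset.card_filter_le _ _).trans (card_gridIndex_le D n))
    have h2 : 3 ^ D * 256 ^ (D * n) ≤ 3 ^ D * 65536 ^ (D * n) := by gcongr; norm_num
    exact_mod_cast h1.trans h2

/-- Successive interpolations differ at a point by a double convex combination of increments of `X`
between neighbouring points of the two grids, so they converge locally uniformly. -/
theorem IsLocallyKolmogorov.ae_summable_gridInterp {D : ℕ} {Ω : Type*} [MeasurableSpace Ω]
    {X : (Fin D → ℝ) → Ω → ℝ} {P : Measure Ω} (hX : ∀ t, Measurable (X t))
    (h : IsLocallyKolmogorov X P) :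
    ∀ᵐ w ∂P, Summable fun n => gridInterp X (n + 1) w - gridInterp X n w := by
  classical
  have hsum : ∀ᵐ w ∂P, ∀ N : ℕ, Summable fun n => (2 ^ n : ℝ) ^ (16 * D + 1) *
      ∑ q ∈ ((gridIndex D (n + 1) ×ˢ gridIndex D n).image fun k =>
        ((gridPoint (n + 1) k.1, gridPoint n k.2) : (Fin D → ℝ) × (Fin D → ℝ))).filter
          fun q => ‖q.1‖ ≤ N + 1 ∧ ‖q.2‖ ≤ N + 1 ∧ ‖q.1 - q.2‖ ≤ 2 / 16 ^ n,
        |X q.1 w - X q.2 w| ^ (16 * D + 2) := by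
    refine ae_all_iff.2 fun N => h.ae_summable hX (N + 1) (9 ^ D * 256 ^ D) _
      (fun n q hq => (Finset.mem_filter.1 hq).2) fun n => ?_
    have h1 : (((gridIndex D (n + 1) ×ˢ gridIndex D n).image fun k =>
        ((gridPoint (n + 1) k.1, gridPoint n k.2) : (Fin D → ℝ) × (Fin D → ℝ))).filter
          fun q => ‖q.1‖ ≤ N + 1 ∧ ‖q.2‖ ≤ N + 1 ∧ ‖q.1 - q.2‖ ≤ 2 / 16 ^ n).card ≤
        (3 ^ D * 256 ^ (D * (n + 1))) * (3 ^ D * 256 ^ (D * n)) := by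
      refine (Finset.card_filter_le _ _).trans (Finset.card_image_le.trans ?_)
      rw [Finset.card_product]
      exact Nat.mul_le_mul (card_gridIndex_le _ _) (card_gridIndex_le _ _)
    have h2 : (3 ^ D * 256 ^ (D * (n + 1))) * (3 ^ D * 256 ^ (D * n)) =
        9 ^ D * 256 ^ D * 65536 ^ (D * n) := by
      rw [show 9 = 3 * 3 by norm_num, show 65536 = 256 * 256 by norm_num, mul_pow, mul_pow,
        Nat.mul_add, pow_add]
      ring
    exact_mod_cast h1.trans_eq h2
  filter_upwards [hsum] with w hw
  refine ContinuousMap.summable_of_locally_summable_norm fun K => ?_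
  obtain ⟨R, hR⟩ := K.isCompact.isBounded.exists_norm_le
  obtain ⟨N, hN⟩ := exists_nat_ge R
  have h2 : Summable fun n : ℕ => ((2 : ℝ) ^ n)⁻¹ := by
    simpa using summable_geometric_of_lt_one (r := (2 : ℝ)⁻¹) (by norm_num) (by norm_num)
  refine Summable.of_norm_bounded_eventually_nat (h2.add (hw N)) ?_
  obtain ⟨M, hM⟩ := pow_unbounded_of_one_lt R (by norm_num : (1 : ℝ) < 16)
  filter_upwards [eventually_ge_atTop M] with n hn
  rw [norm_norm]
  refine (ContinuousMap.norm_le _ (by positivity)).2 fun t => ?_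
  have htR := hR t t.2
  have ht : ‖(t : Fin D → ℝ)‖ < 16 ^ n := htR.trans_lt
    (hM.trans_le (pow_le_pow_right₀ (by norm_num) hn))
  have ht' : ‖(t : Fin D → ℝ)‖ < 16 ^ (n + 1) :=
    ht.trans_le (pow_le_pow_right₀ (by norm_num) n.le_succ)
  rw [ContinuousMap.restrict_apply, ContinuousMap.sub_apply, Real.norm_eq_abs,
    gridInterp_apply X (n + 1)]
  refine abs_sum_mul_sub_le (fun k _ => gridBump_nonneg _ k _) (sum_gridBump ht')
      fun k hk hk0 => ?_
  rw [abs_sub_comm, gridInterp_apply]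
  refine abs_sum_mul_sub_le (fun k _ => gridBump_nonneg _ k _) (sum_gridBump ht)
      fun l hl hl0 => ?_
  rw [abs_sub_comm]
  refine (abs_le_inv_add_pow_mul (A := 2 ^ n) (by positivity) (16 * D + 1)).trans ?_
  gcongr
  have hk1 := norm_gridPoint_sub_le hk0
  have hl1 := norm_gridPoint_sub_le hl0
  have h1 : (1 : ℝ) / 16 ^ n ≤ 1 := by
    rw [div_le_one (by positivity)]; exact one_le_pow₀ (by norm_num)
  have h1' : (1 : ℝ) / 16 ^ (n + 1) ≤ 1 / 16 ^ n := by
    gcongr <;> norm_num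
  have hk2 := norm_add_le (gridPoint (n + 1) k - t) t
  have hl2 := norm_add_le (gridPoint n l - t) t
  rw [sub_add_cancel] at hk2 hl2
  have hkl := norm_sub_le (gridPoint (n + 1) k - t) (gridPoint n l - (t : Fin D → ℝ))
  rw [sub_sub_sub_cancel_right] at hkl
  refine Finset.single_le_sum (f := fun q : (Fin D → ℝ) × (Fin D → ℝ) =>
      |X q.1 w - X q.2 w| ^ (16 * D + 2)) (fun q _ => by positivity)
      (a := (gridPoint (n + 1) k, gridPoint n l))
      (Finset.mem_filter.2 ⟨Finset.mem_image.2 ⟨(k, l), Finset.mem_product.2 ⟨hk, hl⟩, rfl⟩,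
        ?_, ?_, ?_⟩)
  · simp only; linarith
  · simp only; linarith
  · simp only
    have : (2 : ℝ) / 16 ^ n = 1 / 16 ^ n + 1 / 16 ^ n := by ring
    linarith

/-- Kolmogorov's continuity criterion, with the modification a random element of the space of
continuous functions. -/
theorem IsLocallyKolmogorov.exists_continuous_modification {D : ℕ} {Ω : Type*}
    [MeasurableSpace Ω] {X : (Fin D → ℝ) → Ω → ℝ} {P : Measure Ω} (hX : ∀ t, Measurable (X t))
    (h : IsLocallyKolmogorov X P) :
    ∃ F : Ω → C(Fin D → ℝ, ℝ), Measurable F ∧ ∀ t, (fun w => F w t) =ᵐ[P] X t := by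
  have hlim : ∀ᵐ w ∂P, ∃ l, Tendsto (fun n => gridInterp X n w) atTop (𝓝 l) := by
    filter_upwards [h.ae_summable_gridInterp hX] with w hw
    have h1 := (hw.hasSum.tendsto_sum_nat).const_add (gridInterp X 0 w)
    simp only [Finset.sum_range_sub (fun n => gridInterp X n w), add_sub_cancel] at h1
    exact ⟨_, h1⟩
  obtain ⟨F, hF, hFlim⟩ := measurable_limit_of_tendsto_metrizable_ae
    (fun n => (measurable_gridInterp hX n).aemeasurable) hlim
  refine ⟨F, hF, fun t => ?_⟩
  filter_upwards [hFlim, h.ae_tendsto_gridInterp hX t] with w h1 h2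
  exact tendsto_nhds_unique
    (((ContinuousEvalConst.continuous_eval_const t).tendsto _).comp h1) h2

/-! ### Continuous versions of Gaussian fields -/

theorem lintegral_abs_pow_gaussianReal (σ : ℝ) (m : ℕ) :
    ∫⁻ x, ENNReal.ofReal (|x| ^ (2 * m)) ∂(gaussianReal 0 (σ ^ 2).toNNReal) =
      ENNReal.ofReal ((σ ^ 2) ^ m * ∫ x, |x| ^ (2 * m) ∂(gaussianReal 0 1)) := by
  have h1 := gaussianReal_map_const_mul (μ := 0) (v := 1) σ
  have h2 : NNReal.mk (σ ^ 2) (sq_nonneg σ) * 1 = (σ ^ 2).toNNReal := by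
    ext; simp [sq_nonneg]
  rw [mul_zero, h2] at h1
  have hint : Integrable (fun x : ℝ => |x| ^ (2 * m)) (gaussianReal 0 1) := by
    have := (memLp_id_gaussianReal' (μ := 0) (v := 1) ((2 * m : ℕ) : ENNReal)
      (ENNReal.natCast_ne_top _)).integrable_norm_pow'
    simpa using this
  rw [← h1, lintegral_map (by fun_prop) (by fun_prop), ENNReal.ofReal_mul (by positivity),
    ofReal_integral_eq_lintegral_ofReal hint (Eventually.of_forall fun x => by positivity),
    ← lintegral_const_mul _ (by fun_prop)]
  refine lintegral_congr fun x => ?_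
  rw [← ENNReal.ofReal_mul (by positivity), abs_mul, mul_pow, ← pow_mul, pow_mul |σ|, sq_abs,
    ← pow_mul]

/-- An isonormal process restricted to a locally `1/2`-Hölder family of vectors has a version with
continuous paths, since the moments of a Gaussian increment are powers of its variance. -/
theorem exists_continuous_gaussian_field {H : Type*} [NormedAddCommGroup H] [InnerProductSpace ℝ H]
    {Ω : Type*} [MeasurableSpace Ω] {P : Measure Ω} [IsProbabilityMeasure P]
    (W : H →ₗᵢ[ℝ] Lp ℝ 2 P) (hW : ∀ h, P.map (W h) = gaussianReal 0 (‖h‖ ^ 2).toNNReal)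
    {D : ℕ} (v : (Fin D → ℝ) → H)
    (hv : ∀ R : ℝ, ∃ C : ℝ, 0 ≤ C ∧ ∀ s t, ‖s‖ ≤ R → ‖t‖ ≤ R → ‖v s - v t‖ ^ 2 ≤ C * ‖s - t‖) :
    ∃ F : Ω → C(Fin D → ℝ, ℝ), Measurable F ∧ ∀ t, (fun w => F w t) =ᵐ[P] W (v t) := by
  refine IsLocallyKolmogorov.exists_continuous_modification
    (fun t => (Lp.stronglyMeasurable (W (v t))).measurable) fun R => ?_
  obtain ⟨C, hC, hCb⟩ := hv R
  set M := ∫ x, |x| ^ (2 * (8 * D + 1)) ∂(gaussianReal 0 1) with hM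
  have hM0 : 0 ≤ M := integral_nonneg fun x => by positivity
  refine ⟨C ^ (8 * D + 1) * M, by positivity, fun s t hs ht => ?_⟩
  have h1 : ∫⁻ w, ENNReal.ofReal (|W (v s) w - W (v t) w| ^ (16 * D + 2)) ∂P =
      ∫⁻ w, ENNReal.ofReal (|W (v s - v t) w| ^ (2 * (8 * D + 1))) ∂P := by
    refine lintegral_congr_ae ?_
    rw [map_sub]
    filter_upwards [Lp.coeFn_sub (W (v s)) (W (v t))] with w hw
    rw [hw, Pi.sub_apply]
    ring_nf
  have h2 := lintegral_abs_pow_gaussianReal ‖v s - v t‖ (8 * D + 1)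
  rw [← hW, lintegral_map (by fun_prop) (Lp.stronglyMeasurable _).measurable] at h2
  rw [h1, h2]
  refine ENNReal.ofReal_le_ofReal ?_
  calc (‖v s - v t‖ ^ 2) ^ (8 * D + 1) * M ≤ (C * ‖s - t‖) ^ (8 * D + 1) * M := by
        gcongr
        exact hCb s t hs ht
    _ = C ^ (8 * D + 1) * M * ‖s - t‖ ^ (8 * D + 1) := by ring

theorem IsCenteredGaussianField.map {T Ω S : Type*} [MeasurableSpace Ω] [MeasurableSpace S]
    {X : T → S → ℝ} {C : T → T → ℝ} {P : Measure Ω} {G : Ω → S} (hG : Measurable G)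
    (hX : ∀ t, Measurable (X t)) (h : IsCenteredGaussianField (fun t w => X t (G w)) C P) :
    IsCenteredGaussianField X C (P.map G) where
  isProbabilityMeasure :=
    have := h.isProbabilityMeasure
    Measure.isProbabilityMeasure_map hG.aemeasurable
  isGaussianProcess := ⟨fun I => ⟨by
    have hI : Measurable fun w => I.restrict fun t => X t w :=
      measurable_pi_lambda _ fun t => hX t
    rw [Measure.map_map hI hG]
    obtain ⟨_, hgauss, _, _⟩ := h
    exact (hgauss.hasGaussianLaw I).isGaussian_map⟩⟩
  mean_eq_zero t := by
    rw [integral_map hG.aemeasurable (hX t).aestronglyMeasurable]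
    exact h.mean_eq_zero t
  covariance_eq s t := by
    rw [integral_map hG.aemeasurable ((hX s).fun_mul (hX t)).aestronglyMeasurable]
    exact h.covariance_eq s t

theorem IsCenteredGaussianField.congr {T Ω : Type*} [MeasurableSpace Ω]
    {X Y : T → Ω → ℝ} {C : T → T → ℝ} {P : Measure Ω} (h : IsCenteredGaussianField X C P)
    (hXY : ∀ t, X t =ᵐ[P] Y t) : IsCenteredGaussianField Y C P where
  isProbabilityMeasure := h.isProbabilityMeasure
  isGaussianProcess := by
    obtain ⟨_, hgauss, _, _⟩ := h
    exact hgauss.congr hXY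
  mean_eq_zero t := by rw [← h.mean_eq_zero t]; exact integral_congr_ae (hXY t).symm
  covariance_eq s t := by
    rw [← h.covariance_eq s t]; exact integral_congr_ae ((hXY s).symm.mul (hXY t).symm)

/-- The isonormal process restricted to a family of vectors is a centred Gaussian field whose
covariance is the Gram matrix. -/
theorem isCenteredGaussianField_of_linearIsometry {H : Type*} [NormedAddCommGroup H]
    [InnerProductSpace ℝ H] {Ω : Type*} [MeasurableSpace Ω] {P : Measure Ω}
    [IsProbabilityMeasure P] (W : H →ₗᵢ[ℝ] Lp ℝ 2 P)
    (hW : ∀ h, P.map (W h) = gaussianReal 0 (‖h‖ ^ 2).toNNReal) {T : Type*} (v : T → H) :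
    IsCenteredGaussianField (fun t w => W (v t) w) (fun s t => inner ℝ (v s) (v t)) P where
  isProbabilityMeasure := inferInstance
  isGaussianProcess := ⟨fun I => ⟨by
    classical
    have hm : ∀ h, Measurable (W h) := fun h => (Lp.stronglyMeasurable (W h)).measurable
    have hI : Measurable fun w => I.restrict fun t => W (v t) w :=
      measurable_pi_lambda _ fun t => hm _
    refine isGaussian_of_map_eq_gaussianReal fun L =>
      ⟨0, (‖∑ t : I, L (Pi.single t 1) • v t‖ ^ 2).toNNReal, ?_⟩
    rw [Measure.map_map (by fun_prop) hI, ← hW (∑ t : I, L (Pi.single t 1) • v t)]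
    refine Measure.map_congr ?_
    have h1 : ∀ᵐ w ∂P, ∀ t : I, (L (Pi.single t 1) • W (v t) : Lp ℝ 2 P) w =
        L (Pi.single t 1) * W (v t) w := by
      refine ae_all_iff.2 fun t => ?_
      filter_upwards [Lp.coeFn_smul (L (Pi.single t 1)) (W (v t))] with w hw
      rw [hw, Pi.smul_apply, smul_eq_mul]
    simp only [map_sum, map_smul]
    filter_upwards [h1, Lp.coeFn_finsetSum Finset.univ
      fun t : I => (L (Pi.single t 1) • W (v t) : Lp ℝ 2 P)] with w h2 h3
    rw [h3, Finset.sum_apply, Function.comp_apply]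
    simp only [h2]
    conv_lhs => rw [← Finset.univ_sum_single (I.restrict fun t => W (v t) w), map_sum]
    refine Finset.sum_congr rfl fun t _ => ?_
    have : Pi.single t (I.restrict (fun t => W (v t) w) t) =
        W (v t) w • (Pi.single t (1 : ℝ) : I → ℝ) := by
      ext j
      by_cases hj : j = t
      · subst hj; simp
      · simp [hj]
    rw [this, map_smul, smul_eq_mul, mul_comm]⟩⟩
  mean_eq_zero t := by
    have h := integral_id_gaussianReal (μ := 0) (v := (‖v t‖ ^ 2).toNNReal)
    rwa [← hW, integral_map (Lp.stronglyMeasurable _).measurable.aemeasurable (by fun_prop)] at h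
  covariance_eq s t := by
    rw [← W.inner_map_map, L2.inner_def]
    simp [mul_comm]

/-! ### Normalized indicators of balls in `L²` -/

theorem inner_ballVec {d : ℕ} (b c : BallSpace d) :
    inner ℝ (ballVec b) (ballVec c) =
      (volume.real (Metric.ball (0 : Space d) b.2))⁻¹ *
        (volume.real (Metric.ball (0 : Space d) c.2))⁻¹ *
          volume.real (Metric.ball b.1 (b.2 : ℝ) ∩ Metric.ball c.1 (c.2 : ℝ)) := by
  rw [ballVec, ballVec, real_inner_smul_left, real_inner_smul_right,
    L2.real_inner_indicatorConstLp_one_indicatorConstLp_one]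
  ring

theorem volume_real_ball_eq {d : ℕ} (x : Space d) {r : ℝ} (hr : 0 < r) :
    volume.real (Metric.ball x r) = r ^ d * volume.real (Metric.ball (0 : Space d) 1) := by
  rw [Measure.real, Measure.addHaar_ball_of_pos _ _ hr]
  simp [Measure.real, hr.le]

theorem volume_real_ball_pos (d : ℕ) : 0 < volume.real (Metric.ball (0 : Space d) 1) :=
  ENNReal.toReal_pos (Metric.measure_ball_pos _ _ one_pos).ne' measure_ball_lt_top.ne

theorem pow_mul_le_volume_real_inter {d : ℕ} [NeZero d] (x y : Space d) (r s : ℝ) :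
    max 0 (min r s - dist x y) ^ d * volume.real (Metric.ball (0 : Space d) 1) ≤
      volume.real (Metric.ball x r ∩ Metric.ball y s) := by
  rcases le_or_gt (min r s - dist x y) 0 with h | h
  · rw [max_eq_left h, zero_pow (NeZero.ne d), zero_mul]
    exact measureReal_nonneg
  · rw [max_eq_right h.le, ← volume_real_ball_eq x h]
    refine measureReal_mono (subset_inter ?_ ?_) ?_
    · exact Metric.ball_subset_ball (by linarith [min_le_left r s, dist_nonneg (x := x) (y := y)])
    · exact Metric.ball_subset_ball' (by linarith [min_le_right r s])
    · exact measure_ne_top_of_subset inter_subset_left measure_ball_lt_top.ne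

/-- The squared norm is `|b|⁻¹ + |c|⁻¹ - 2 |b|⁻¹ |c|⁻¹ |b ∩ c|`, and `b ∩ c` contains a ball whose
radius differs from those of `b` and `c` by at most `dist b.1 c.1 + |b.2 - c.2|`. -/
theorem norm_ballVec_sub_sq_le {d : ℕ} [NeZero d] {m M : ℝ} (hm : 0 < m) {b c : BallSpace d}
    (hb : m ≤ b.2) (hc : m ≤ c.2) (hb' : b.2 ≤ M) (hc' : c.2 ≤ M) :
    ‖ballVec b - ballVec c‖ ^ 2 ≤
      2 * d * M ^ (d - 1) / (volume.real (Metric.ball (0 : Space d) 1) * m ^ d * m ^ d) *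
        (dist b.1 c.1 + |(b.2 : ℝ) - c.2|) := by
  obtain ⟨x, r, hr⟩ := b
  obtain ⟨y, s, hs⟩ := c
  simp only at hb hc hb' hc' ⊢
  have hr : 0 < r := hr
  have hs : 0 < s := hs
  set κ := volume.real (Metric.ball (0 : Space d) 1) with hκ
  have hκ0 : 0 < κ := volume_real_ball_pos d
  set δ := dist x y with hδ
  have hδ0 : 0 ≤ δ := dist_nonneg
  set ρ := max 0 (min r s - δ) with hρ
  have hρ0 : 0 ≤ ρ := le_max_left _ _
  have hρr : ρ ≤ r := max_le hr.le (by linarith [min_le_left r s])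
  have hρs : ρ ≤ s := max_le hs.le (by linarith [min_le_right r s])
  have hρ' : min r s - δ ≤ ρ := le_max_right _ _
  have hmin : r ≤ min r s + |r - s| ∧ s ≤ min r s + |r - s| := by
    rcases le_total r s with h | h
    · rw [min_eq_left h, abs_of_nonpos (sub_nonpos.2 h)]
      constructor <;> linarith
    · rw [min_eq_right h, abs_of_nonneg (sub_nonneg.2 h)]
      constructor <;> linarith
  have hpow : ∀ u, 0 < u → u ≤ M → ρ ≤ u → u - ρ ≤ δ + |r - s| →
      u ^ d - ρ ^ d ≤ d * M ^ (d - 1) * (δ + |r - s|) := by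
    intro u hu huM hρu hle
    have h1 := (le_abs_self _).trans (abs_pow_sub_pow_le u ρ d)
    rw [abs_of_nonneg (sub_nonneg.2 hρu), abs_of_pos hu, abs_of_nonneg hρ0, max_eq_left hρu] at h1
    calc u ^ d - ρ ^ d ≤ (u - ρ) * d * u ^ (d - 1) := h1
      _ ≤ (δ + |r - s|) * d * M ^ (d - 1) := by gcongr
      _ = _ := by ring
  have h1 := hpow r hr hb' hρr (by linarith [hmin.1])
  have h2 := hpow s hs hc' hρs (by linarith [hmin.2])
  have hI : ρ ^ d * κ ≤ volume.real (Metric.ball x r ∩ Metric.ball y s) :=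
    pow_mul_le_volume_real_inter x y r s
  set I := volume.real (Metric.ball x r ∩ Metric.ball y s) with hIdef
  rw [norm_sub_sq_real, ← real_inner_self_eq_norm_sq, ← real_inner_self_eq_norm_sq, inner_ballVec,
    inner_ballVec, inner_ballVec]
  simp only [inter_self]
  rw [volume_real_ball_eq x hr, volume_real_ball_eq y hs, volume_real_ball_eq 0 hr,
    volume_real_ball_eq 0 hs, ← hκ, ← hIdef]
  have e1 : (r ^ d * κ)⁻¹ * (r ^ d * κ)⁻¹ * (r ^ d * κ) - 2 * ((r ^ d * κ)⁻¹ * (s ^ d * κ)⁻¹ * I) +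
      (s ^ d * κ)⁻¹ * (s ^ d * κ)⁻¹ * (s ^ d * κ) =
      (r ^ d * κ)⁻¹ * (s ^ d * κ)⁻¹ * (s ^ d * κ + r ^ d * κ - 2 * I) := by
    field_simp
    ring
  rw [e1]
  calc (r ^ d * κ)⁻¹ * (s ^ d * κ)⁻¹ * (s ^ d * κ + r ^ d * κ - 2 * I)
      ≤ (r ^ d * κ)⁻¹ * (s ^ d * κ)⁻¹ * (κ * (2 * d * M ^ (d - 1) * (δ + |r - s|))) := by
        gcongr
        nlinarith
    _ ≤ (m ^ d * κ)⁻¹ * (m ^ d * κ)⁻¹ * (κ * (2 * d * M ^ (d - 1) * (δ + |r - s|))) := by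
        have hM : 0 ≤ M := by linarith
        gcongr
    _ = _ := by field_simp

/-- The ball with centre `(p 1, …, p d)` and radius `exp (p 0)`. -/
noncomputable def ballOfCoord {d : ℕ} (p : Fin (d + 1) → ℝ) : BallSpace d :=
  (WithLp.toLp 2 fun i => p i.succ, ⟨Real.exp (p 0), Real.exp_pos _⟩)

/-- The logarithm of the radius followed by the coordinates of the centre: a global chart that
identifies the space of balls with `ℝ^(d + 1)`. -/
noncomputable def ballCoord (d : ℕ) : C(BallSpace d, Fin (d + 1) → ℝ) where
  toFun b := Fin.cons (Real.log b.2) (fun i => b.1 i)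
  continuous_toFun := by
    refine continuous_pi fun i => ?_
    refine Fin.cases ?_ (fun i => ?_) i
    · simp only [Fin.cons_zero]
      exact (continuous_subtype_val.comp continuous_snd).log fun b => (ne_of_gt b.2.2)
    · simp only [Fin.cons_succ]
      fun_prop

theorem ballOfCoord_ballCoord {d : ℕ} (b : BallSpace d) : ballOfCoord (ballCoord d b) = b := by
  obtain ⟨x, r, hr⟩ := b
  refine Prod.ext ?_ (Subtype.ext ?_)
  · ext i
    simp [ballOfCoord, ballCoord]
  · simp [ballOfCoord, ballCoord, Real.exp_log (show 0 < r from hr)]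

theorem abs_exp_sub_exp_le {a b R : ℝ} (ha : a ≤ R) (hb : b ≤ R) :
    |Real.exp a - Real.exp b| ≤ Real.exp R * |a - b| := by
  wlog h : b ≤ a generalizing a b
  · rw [abs_sub_comm, abs_sub_comm a]
    exact this hb ha (le_of_not_ge h)
  have h1 : Real.exp a * Real.exp (b - a) = Real.exp b := by rw [← Real.exp_add]; ring_nf
  have h2 := Real.add_one_le_exp (b - a)
  rw [abs_of_nonneg (sub_nonneg.2 (Real.exp_le_exp.2 h)), abs_of_nonneg (sub_nonneg.2 h)]
  calc Real.exp a - Real.exp b ≤ Real.exp a * (a - b) := by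
        nlinarith [Real.exp_pos a]
    _ ≤ _ := by
        have := sub_nonneg.2 h
        gcongr

theorem exists_norm_ballVec_ballOfCoord_sub_sq_le (d : ℕ) [NeZero d] (R : ℝ) :
    ∃ C : ℝ, 0 ≤ C ∧ ∀ s t : Fin (d + 1) → ℝ, ‖s‖ ≤ R → ‖t‖ ≤ R →
      ‖ballVec (ballOfCoord s) - ballVec (ballOfCoord t)‖ ^ 2 ≤ C * ‖s - t‖ := by
  set L : (Fin d → ℝ) →L[ℝ] Space d :=
    ((EuclideanSpace.equiv (Fin d) ℝ).symm : (Fin d → ℝ) →L[ℝ] EuclideanSpace ℝ (Fin d))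
  have hκ0 := volume_real_ball_pos d
  set A := 2 * d * Real.exp R ^ (d - 1) /
    (volume.real (Metric.ball (0 : Space d) 1) * Real.exp (-R) ^ d * Real.exp (-R) ^ d)
  have hA : 0 ≤ A := by positivity
  refine ⟨A * (‖L‖ + Real.exp R), by positivity, fun s t hs ht => ?_⟩
  have hcoord : ∀ u : Fin (d + 1) → ℝ, ‖u‖ ≤ R → -R ≤ u 0 ∧ u 0 ≤ R := fun u hu =>
    abs_le.1 ((norm_le_pi_norm u 0).trans hu)
  obtain ⟨hs1, hs2⟩ := hcoord s hs
  obtain ⟨ht1, ht2⟩ := hcoord t ht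
  have h1 := norm_ballVec_sub_sq_le (b := ballOfCoord s) (c := ballOfCoord t) (Real.exp_pos (-R))
    (Real.exp_le_exp.2 hs1) (Real.exp_le_exp.2 ht1) (Real.exp_le_exp.2 hs2) (Real.exp_le_exp.2 ht2)
  refine h1.trans ?_
  rw [mul_assoc A]
  refine mul_le_mul_of_nonneg_left ?_ hA
  rw [add_mul]
  refine add_le_add ?_ ?_
  · have h2 : dist (ballOfCoord s).1 (ballOfCoord t).1 = ‖L fun i => (s - t) i.succ‖ := by
      rw [dist_eq_norm]; rfl
    rw [h2]
    refine (L.le_opNorm _).trans (mul_le_mul_of_nonneg_left ?_ (norm_nonneg _))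
    exact (pi_norm_le_iff_of_nonneg (norm_nonneg _)).2 fun i => norm_le_pi_norm (s - t) i.succ
  · refine (abs_exp_sub_exp_le hs2 ht2).trans ?_
    gcongr
    exact norm_le_pi_norm (s - t) 0

instance instLocallyCompactSpaceBallSpace (d : ℕ) : LocallyCompactSpace (BallSpace d) :=
  have : LocallyCompactSpace (Ioi (0 : ℝ)) := isOpen_Ioi.locallyCompactSpace
  inferInstance

/-! ### Existence, uniqueness and invariance of the field measure -/

/-- Existence of the Gaussian measure for a positive semidefinite operator. Strict positivity is not
assumed, so that the statement applies to the two parts of a reflection positive operator. -/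
theorem exists_isFieldMeasure {d : ℕ} [NeZero d] (A : L2 d →L[ℝ] L2 d)
    (hs : ∀ x y, inner ℝ x (A y) = inner ℝ y (A x)) (hp : ∀ x, 0 ≤ inner ℝ x (A x)) :
    ∃ ν : Measure C(BallSpace d, ℝ), IsFieldMeasure A ν := by
  obtain ⟨H, _, _, _, j, hj⟩ := exists_linearMap_inner_eq
    ((innerₗ (L2 d)).compl₂ A.toLinearMap) (fun x y => hs x y) (fun x => hp x)
  have hj' : ∀ x y, inner ℝ (j x) (j y) = inner ℝ x (A y) := hj
  obtain ⟨Ω, _, P, _, W, hW⟩ := exists_linearIsometry_map_eq_gaussianReal H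
  have hjn : ∀ x, ‖j x‖ ^ 2 ≤ ‖A‖ * ‖x‖ ^ 2 := fun x => by
    rw [← real_inner_self_eq_norm_sq, hj']
    calc inner ℝ x (A x) ≤ ‖x‖ * ‖A x‖ := real_inner_le_norm _ _
      _ ≤ ‖x‖ * (‖A‖ * ‖x‖) := by gcongr; exact A.le_opNorm x
      _ = _ := by ring
  obtain ⟨F, hF, hFW⟩ := exists_continuous_gaussian_field W hW
    (fun p : Fin (d + 1) → ℝ => j (ballVec (ballOfCoord p))) fun R => by
      obtain ⟨C, hC, h⟩ := exists_norm_ballVec_ballOfCoord_sub_sq_le d R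
      refine ⟨‖A‖ * C, by positivity, fun s t h1 h2 => ?_⟩
      rw [← map_sub, mul_assoc]
      exact (hjn _).trans (by gcongr; exact h s t h1 h2)
  have heval : ∀ b : BallSpace d, Measurable fun f : C(BallSpace d, ℝ) => f b := fun b =>
    (ContinuousEvalConst.continuous_eval_const b).measurable
  have hG : Measurable fun w => (F w).comp (ballCoord d) :=
    (ContinuousMap.continuous_precomp (ballCoord d)).measurable.comp hF
  refine ⟨P.map fun w => (F w).comp (ballCoord d),
    IsCenteredGaussianField.map hG heval ?_⟩
  have h1 := isCenteredGaussianField_of_linearIsometry W hW fun b : BallSpace d => j (ballVec b)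
  simp only [hj'] at h1
  refine h1.congr fun b => ?_
  filter_upwards [hFW (ballCoord d b)] with w hw
  rw [ContinuousMap.comp_apply, hw, ballOfCoord_ballCoord]

theorem IsStrictlyPositiveOperator.inner_comm {d : ℕ} {A : L2 d →L[ℝ] L2 d}
    (hA : IsStrictlyPositiveOperator A) (x y : L2 d) : inner ℝ x (A y) = inner ℝ y (A x) := by
  rw [real_inner_comm]
  exact (ContinuousLinearMap.isSelfAdjoint_iff_isSymmetric.1 hA.1) y x

theorem IsStrictlyPositiveOperator.inner_nonneg {d : ℕ} {A : L2 d →L[ℝ] L2 d}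
    (hA : IsStrictlyPositiveOperator A) (x : L2 d) : 0 ≤ inner ℝ x (A x) := by
  rcases eq_or_ne x 0 with rfl | h
  · simp
  · exact (hA.2 x h).le

theorem IsFieldMeasure.integral_cexp_sum {d : ℕ} {A : L2 d →L[ℝ] L2 d}
    {ν : Measure C(BallSpace d, ℝ)} (h : IsFieldMeasure A ν) {ι : Type*} (I : Finset ι)
    (b : ι → BallSpace d) (c : ι → ℝ) :
    ∫ f, Complex.exp ((∑ i ∈ I, c i * f (b i) : ℝ) * Complex.I) ∂ν =
      Complex.exp (-((inner ℝ (∑ i ∈ I, c i • ballVec (b i))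
        (A (∑ i ∈ I, c i • ballVec (b i))) : ℝ) : ℂ) / 2) := by
  rw [IsCenteredGaussianField.integral_cexp_sum h I b c]
  congr 4
  rw [map_sum, sum_inner]
  refine Finset.sum_congr rfl fun i _ => ?_
  rw [inner_sum]
  refine Finset.sum_congr rfl fun j _ => ?_
  rw [map_smul, real_inner_smul_left, real_inner_smul_right, kernel]
  ring

theorem measurable_eval {X : Type*} [TopologicalSpace X] (x : X) :
    Measurable fun f : C(X, ℝ) => f x :=
  (ContinuousEvalConst.continuous_eval_const x).measurable

theorem instMeasurableSpace_eq_iSup_comap (X : Type*) [TopologicalSpace X]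
    [SecondCountableTopology X] [LocallyCompactSpace X] :
    instMeasurableSpaceContinuousMap X =
      ⨆ x : X, MeasurableSpace.comap (fun f : C(X, ℝ) => f x) inferInstance :=
  borel_continuousMap_eq_iSup_comap_eval X

theorem IsFieldMeasure.unique {d : ℕ} {A : L2 d →L[ℝ] L2 d} {ν ν' : Measure C(BallSpace d, ℝ)}
    (h : IsFieldMeasure A ν) (h' : IsFieldMeasure A ν') : ν = ν' := by
  have := h.isProbabilityMeasure
  have := h'.isProbabilityMeasure
  refine measure_ext_of_integral_cexp_sum (fun b f => f b)
    (instMeasurableSpace_eq_iSup_comap (BallSpace d)) fun I c => ?_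
  rw [h.integral_cexp_sum I (fun b => b) c, h'.integral_cexp_sum I (fun b => b) c]

theorem actL2_ballVec {d : ℕ} (g : Motion d) (b : BallSpace d) :
    actL2 g (ballVec b) = ballVec (actBall g b) := by
  rw [ballVec, ballVec, map_smul]
  congr 1
  refine (Lp.indicatorConstLp_compMeasurePreserving measurableSet_ball measure_ball_lt_top.ne
    (1 : ℝ) (measurePreserving_motion g.symm)).trans ?_
  congr 1
  rw [IsometryEquiv.preimage_ball]
  rfl

theorem measurable_actFun {d : ℕ} (g : Motion d) : Measurable (actFun g) :=
  (ContinuousMap.continuous_precomp (actBall g.symm)).measurable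

theorem IsFieldMeasure.isInvariantMeasure {d : ℕ} {A : L2 d →L[ℝ] L2 d}
    {ν : Measure C(BallSpace d, ℝ)} (h : IsFieldMeasure A ν) (hA : IsInvariantOperator A) :
    IsInvariantMeasure ν := by
  intro g
  have := h.isProbabilityMeasure
  have := Measure.isProbabilityMeasure_map (μ := ν) (measurable_actFun g).aemeasurable
  refine measure_ext_of_integral_cexp_sum (fun b f => f b)
    (instMeasurableSpace_eq_iSup_comap (BallSpace d)) fun I c => ?_
  rw [integral_map (measurable_actFun g).aemeasurable
    (Measurable.aestronglyMeasurable (by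
      have : Measurable fun f : C(BallSpace d, ℝ) => ∑ b ∈ I, c b * f b :=
        Finset.measurable_fun_sum _ fun b _ => (measurable_eval b).const_mul _
      fun_prop))]
  have h1 := h.integral_cexp_sum I (fun b => actBall g.symm b) c
  have h2 : ∑ b ∈ I, c b • ballVec (actBall g.symm b) =
      actL2 g.symm (∑ b ∈ I, c b • ballVec b) := by
    simp only [map_sum, map_smul, actL2_ballVec]
  rw [h2, hA, LinearIsometry.inner_map_map, ← h.integral_cexp_sum I (fun b => b) c] at h1
  exact h1

/-! ### The reflection and the half-space -/

theorem reflection_reflection {d : ℕ} [NeZero d] (x : Space d) :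
    reflection d (reflection d x) = x := by
  ext i
  rw [reflection_apply, reflection_apply]
  split_ifs <;> simp

theorem reflection_symm (d : ℕ) [NeZero d] : (reflection d).symm = reflection d := by
  ext1 x
  rw [IsometryEquiv.symm_apply_eq, reflection_reflection]

theorem actL2_reflection_actL2_reflection {d : ℕ} [NeZero d] (f : L2 d) :
    actL2 (reflection d) (actL2 (reflection d) f) = f := by
  have h1 := measurePreserving_motion (reflection d).symm
  refine Lp.ext ?_
  refine (Lp.coeFn_compMeasurePreserving (actL2 (reflection d) f) h1).trans ?_
  refine (h1.quasiMeasurePreserving.ae_eq_comp (Lp.coeFn_compMeasurePreserving f h1)).trans ?_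
  refine Eventually.of_forall fun x => ?_
  simp [reflection_symm, reflection_reflection]

theorem inner_actL2_reflection {d : ℕ} [NeZero d] (f g : L2 d) :
    inner ℝ (actL2 (reflection d) f) g = inner ℝ f (actL2 (reflection d) g) := by
  rw [← (actL2 (reflection d)).inner_map_map, actL2_reflection_actL2_reflection]

/-- The subspace of `L²(ℝ^d)` of the classes of smooth functions with compact support in the open
half-space. -/
def smoothHalf (d : ℕ) [NeZero d] : Submodule ℝ (L2 d) where
  carrier := {F | ∃ f : Space d → ℝ, ContDiff ℝ ∞ f ∧ HasCompactSupport f ∧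
    tsupport f ⊆ halfSpace d ∧ F =ᵐ[volume] f}
  zero_mem' := ⟨0, contDiff_const, HasCompactSupport.zero, by simp, Lp.coeFn_zero _ _ _⟩
  add_mem' := by
    rintro F G ⟨f, hf, hfc, hfs, hF⟩ ⟨g, hg, hgc, hgs, hG⟩
    refine ⟨f + g, hf.add hg, hfc.add hgc, (tsupport_add f g).trans (union_subset hfs hgs), ?_⟩
    exact (Lp.coeFn_add F G).trans (hF.add hG)
  smul_mem' := by
    rintro c F ⟨f, hf, hfc, hfs, hF⟩
    refine ⟨c • f, contDiff_const.smul hf, hfc.smul_left, ?_, ?_⟩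
    · exact (tsupport_smul_subset_right (fun _ => c) f).trans hfs
    · exact (Lp.coeFn_smul c F).trans (hF.const_smul c)

theorem IsReflectionPositiveOperator.inner_nonneg {d : ℕ} [NeZero d] {A : L2 d →L[ℝ] L2 d}
    (hA : IsReflectionPositiveOperator A) {y : L2 d} (hy : y ∈ (smoothHalf d).topologicalClosure) :
    0 ≤ inner ℝ (A y) (actL2 (reflection d) y) := by
  have hcl : IsClosed {y : L2 d | 0 ≤ inner ℝ (A y) (actL2 (reflection d) y)} :=
    isClosed_le continuous_const (A.continuous.inner (actL2 (reflection d)).continuous)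
  refine closure_minimal (fun F hF => ?_) hcl hy
  obtain ⟨f, hf, hfc, hfs, hF⟩ := hF
  have h1 : F = (hf.continuous.memLp_of_hasCompactSupport (p := 2) (μ := volume) hfc).toLp f :=
    Lp.ext (hF.trans (MemLp.coeFn_toLp _).symm)
  have := hA f hf hfc hfs
  rwa [← h1] at this

/-- A vector orthogonal to all test functions of the half-space is orthogonal to the indicator of
the ball, which is a dominated pointwise limit of smooth bump functions supported in smaller closed
balls. -/
theorem ballVec_mem_closure_smoothHalf {d : ℕ} [NeZero d] {b : BallSpace d}
    (hb : b ∈ halfBalls d) : ballVec b ∈ (smoothHalf d).topologicalClosure := by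
  obtain ⟨x, r, hr⟩ := b
  have hr : 0 < r := hr
  have hb : Metric.ball x r ⊆ halfSpace d := hb
  refine Submodule.smul_mem _ _ ?_
  rw [← Submodule.orthogonal_orthogonal_eq_closure, Submodule.mem_orthogonal]
  intro z hz
  rw [real_inner_comm, L2.inner_indicatorConstLp_one measurableSet_ball measure_ball_lt_top.ne]
  let φ : ℕ → ContDiffBump x := fun n =>
    { rIn := r * (1 - 2 / (n + 3))
      rOut := r * (1 - 1 / (n + 3))
      rIn_pos := by
        have : (0 : ℝ) < n + 3 := by positivity
        refine mul_pos hr (sub_pos.2 ?_)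
        rw [div_lt_one this]
        linarith [(n.cast_nonneg : (0 : ℝ) ≤ n)]
      rIn_lt_rOut := by gcongr; norm_num }
  -- The bump `φ n` is `1` on a ball and supported in a larger one, both increasing to `b` with `n`.
  have hrOut : ∀ n, (φ n).rOut < r := fun n => by
    have : (0 : ℝ) < 1 / (n + 3) := by positivity
    change r * (1 - 1 / (n + 3)) < r
    nlinarith
  have hlim : Tendsto (fun n => ∫ w, z w * φ n w) atTop
      (𝓝 (∫ w, z w * (Metric.ball x r).indicator 1 w)) := by
    refine tendsto_integral_of_dominated_convergence
      (fun w => ‖z w * (Metric.ball x r).indicator 1 w‖) (fun n => ?_) ?_ (fun n => ?_) ?_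
    · exact (Lp.aestronglyMeasurable z).mul (φ n).continuous.aestronglyMeasurable
    · refine (MemLp.integrable_mul (p := 2) (q := 2) (Lp.memLp z) ?_).norm
      exact memLp_indicator_const 2 measurableSet_ball 1 (Or.inr measure_ball_lt_top.ne)
    · refine Eventually.of_forall fun w => ?_
      rw [norm_mul, norm_mul]
      gcongr
      by_cases hw : w ∈ Metric.ball x r
      · rw [indicator_of_mem hw, Pi.one_apply, norm_one, Real.norm_eq_abs,
          abs_of_nonneg (φ n).nonneg]
        exact (φ n).le_one
      · have : (φ n).rOut ≤ dist w x := (hrOut n).le.trans (not_lt.1 hw)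
        rw [(φ n).zero_of_le_dist this, norm_zero]
        exact norm_nonneg _
    · refine Eventually.of_forall fun w => Tendsto.const_mul _ ?_
      by_cases hw : w ∈ Metric.ball x r
      · rw [indicator_of_mem hw]
        refine tendsto_const_nhds.congr' ?_
        have h1 : Tendsto (fun n : ℕ => r * (1 - 2 / ((n : ℝ) + 3))) atTop (𝓝 (r * (1 - 0))) := by
          refine (tendsto_const_nhds.sub (Tendsto.div_atTop tendsto_const_nhds ?_)).const_mul r
          exact tendsto_atTop_add_const_right _ _ tendsto_natCast_atTop_atTop
        rw [sub_zero, mul_one] at h1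
        filter_upwards [h1.eventually_const_lt (Metric.mem_ball.1 hw)] with n hn
        exact ((φ n).one_of_mem_closedBall (Metric.mem_closedBall.2 hn.le)).symm
      · rw [indicator_of_notMem hw]
        refine tendsto_const_nhds.congr fun n => ?_
        exact ((φ n).zero_of_le_dist ((hrOut n).le.trans (not_lt.1 hw))).symm
  have hzero : ∀ n, ∫ w, z w * φ n w = 0 := fun n => by
    have hmem := ((φ n).continuous.memLp_of_hasCompactSupport (p := 2) (μ := volume)
      (φ n).hasCompactSupport)
    have h1 : hmem.toLp (φ n) ∈ smoothHalf d := by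
      refine ⟨φ n, (φ n).contDiff, (φ n).hasCompactSupport, ?_, hmem.coeFn_toLp⟩
      rw [(φ n).tsupport_eq]
      exact (Metric.closedBall_subset_ball (hrOut n)).trans hb
    have h2 := hz _ h1
    rw [L2.inner_def] at h2
    rw [← h2]
    refine integral_congr_ae ?_
    filter_upwards [hmem.coeFn_toLp] with w hw
    rw [hw]
    simp
  simp only [hzero] at hlim
  rw [← integral_indicator measurableSet_ball]
  have h3 := tendsto_nhds_unique hlim tendsto_const_nhds
  refine Eq.trans ?_ h3
  refine integral_congr_ae (Eventually.of_forall fun w => ?_)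
  by_cases hw : w ∈ Metric.ball x r <;> simp [hw]

theorem ball_subset_halfSpace_iff {d : ℕ} [NeZero d] (x : Space d) {r : ℝ} (hr : 0 < r) :
    Metric.ball x r ⊆ halfSpace d ↔ r ≤ x 0 := by
  constructor
  · intro h
    by_contra! hlt
    have hx : 0 < x 0 := h (Metric.mem_ball_self hr)
    have hmem : x - x 0 • EuclideanSpace.single (0 : Fin d) (1 : ℝ) ∈ Metric.ball x r := by
      rw [Metric.mem_ball, dist_eq_norm]
      simpa [norm_smul, abs_of_pos hx] using hlt
    have h0 : 0 < (x - x 0 • EuclideanSpace.single (0 : Fin d) (1 : ℝ)) 0 := h hmem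
    simp at h0
  · intro h y hy
    have h1 := (PiLp.norm_apply_le (y - x) 0).trans_lt (by simpa [dist_eq_norm] using hy)
    rw [PiLp.sub_apply, Real.norm_eq_abs, abs_lt] at h1
    change 0 < y 0
    linarith [h1.1]

theorem isClosed_halfBalls (d : ℕ) [NeZero d] : IsClosed (halfBalls d) := by
  have h : halfBalls d = {b : BallSpace d | (b.2 : ℝ) ≤ b.1 0} := by
    ext b
    exact ball_subset_halfSpace_iff b.1 b.2.2
  rw [h]
  exact isClosed_le (by fun_prop) (by fun_prop)

instance instLocallyCompactSpaceHalfBalls (d : ℕ) [NeZero d] : LocallyCompactSpace (halfBalls d) :=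
  (isClosed_halfBalls d).isClosedEmbedding_subtypeVal.locallyCompactSpace

/-! ### Splitting a reflection positive operator -/

/-- The orthogonal projection `P` of `L²(ℝ^d)` onto the closure of the test functions of the
half-space. -/
noncomputable def halfProj (d : ℕ) [NeZero d] : L2 d →L[ℝ] L2 d :=
  (smoothHalf d).topologicalClosure.starProjection

theorem inner_halfProj {d : ℕ} [NeZero d] (x y : L2 d) :
    inner ℝ x (halfProj d y) = inner ℝ (halfProj d x) y :=
  (Submodule.inner_starProjection_left_eq_right _ x y).symm

theorem halfProj_mem {d : ℕ} [NeZero d] (x : L2 d) :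
    halfProj d x ∈ (smoothHalf d).topologicalClosure :=
  Submodule.starProjection_apply_mem _ x

theorem halfProj_eq_self {d : ℕ} [NeZero d] {x : L2 d}
    (hx : x ∈ (smoothHalf d).topologicalClosure) :
    halfProj d x = x := Submodule.starProjection_eq_self_iff.2 hx

/-- The operator `P A θ P`, the covariance between the field on the half-space and its
reflection. -/
noncomputable def sharedPart {d : ℕ} [NeZero d] (A : L2 d →L[ℝ] L2 d) : L2 d →L[ℝ] L2 d :=
  halfProj d ∘L A ∘L (actL2 (reflection d)).toContinuousLinearMap ∘L halfProj d

/-- The operator `P A P - P A θ P`, the conditional covariance of the field on the half-space given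
the part that it shares with its reflection. -/
noncomputable def residualPart {d : ℕ} [NeZero d] (A : L2 d →L[ℝ] L2 d) : L2 d →L[ℝ] L2 d :=
  halfProj d ∘L A ∘L halfProj d - sharedPart A

theorem inner_sharedPart {d : ℕ} [NeZero d] (A : L2 d →L[ℝ] L2 d) (x y : L2 d) :
    inner ℝ x (sharedPart A y) =
    inner ℝ (halfProj d x) (A (actL2 (reflection d) (halfProj d y))) :=
  inner_halfProj x _

theorem inner_residualPart {d : ℕ} [NeZero d] (A : L2 d →L[ℝ] L2 d) (x y : L2 d) :
    inner ℝ x (residualPart A y) =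
    inner ℝ (halfProj d x) (A (halfProj d y)) -
      inner ℝ (halfProj d x) (A (actL2 (reflection d) (halfProj d y))) := by
  rw [residualPart, sub_apply, inner_sub_right, inner_sharedPart]
  congr 1
  exact inner_halfProj x _

theorem inner_apply_actL2_comm {d : ℕ} [NeZero d] {A : L2 d →L[ℝ] L2 d}
    (hA : IsStrictlyPositiveOperator A)
    (hθ : ∀ f : L2 d, A (actL2 (reflection d) f) = actL2 (reflection d) (A f))
    (x y : L2 d) :
    inner ℝ x (A (actL2 (reflection d) y)) = inner ℝ y (A (actL2 (reflection d) x)) := by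
  rw [hA.inner_comm, inner_actL2_reflection, ← hθ]

theorem inner_actL2_apply_actL2 {d : ℕ} [NeZero d] {A : L2 d →L[ℝ] L2 d}
    (hθ : ∀ f : L2 d, A (actL2 (reflection d) f) = actL2 (reflection d) (A f))
    (x y : L2 d) :
    inner ℝ (actL2 (reflection d) x) (A (actL2 (reflection d) y)) = inner ℝ x (A y) := by
  rw [hθ, LinearIsometry.inner_map_map]

theorem inner_residualPart_nonneg {d : ℕ} [NeZero d] {A : L2 d →L[ℝ] L2 d}
    (hA : IsStrictlyPositiveOperator A)
    (hθ : ∀ f : L2 d, A (actL2 (reflection d) f) = actL2 (reflection d) (A f))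
    (x : L2 d) : 0 ≤ inner ℝ x (residualPart A x) := by
  rw [inner_residualPart]
  set y := halfProj d x
  have h := hA.inner_nonneg (y - actL2 (reflection d) y)
  rw [map_sub, inner_sub_left, inner_sub_right, inner_sub_right, inner_actL2_apply_actL2 hθ,
    hA.inner_comm (actL2 (reflection d) y) y] at h
  linarith

/-- The covariance form of the field and its reflection on the half-space is that of `Z + U` and
`Z + U'`, where `Z`, `U`, `U'` are independent with covariance operators `sharedPart A`,
`residualPart A`, `residualPart A`. -/
theorem inner_add_actL2_eq {d : ℕ} [NeZero d] {A : L2 d →L[ℝ] L2 d}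
    (hA : IsStrictlyPositiveOperator A)
    (hθ : ∀ f : L2 d, A (actL2 (reflection d) f) = actL2 (reflection d) (A f))
    {y z : L2 d} (hy : y ∈ (smoothHalf d).topologicalClosure)
    (hz : z ∈ (smoothHalf d).topologicalClosure) :
    inner ℝ (y + actL2 (reflection d) z) (A (y + actL2 (reflection d) z)) =
      inner ℝ (y + z) (sharedPart A (y + z)) + inner ℝ y (residualPart A y) +
        inner ℝ z (residualPart A z) := by
  rw [inner_sharedPart, inner_residualPart, inner_residualPart, halfProj_eq_self hy,
    halfProj_eq_self hz, halfProj_eq_self (Submodule.add_mem _ hy hz)]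
  simp only [map_add, inner_add_left, inner_add_right]
  rw [inner_actL2_apply_actL2 hθ, hA.inner_comm (actL2 (reflection d) z) y,
    inner_apply_actL2_comm hA hθ z y]
  ring

/-! ### Reflection positivity of the field measure -/

theorem measurable_map_prod_of_eval {Ω X : Type*} [MeasurableSpace Ω] [TopologicalSpace X]
    [SecondCountableTopology X] [LocallyCompactSpace X] {F G : Ω → C(X, ℝ)}
    (hF : ∀ x, Measurable fun w => F w x) (hG : ∀ x, Measurable fun w => G w x) :
    Measurable fun w => (F w, G w) :=
  (measurable_of_measurable_eval hF).prodMk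
    (measurable_of_measurable_eval hG)

theorem prod_instMeasurableSpace_eq_iSup (X : Type*) [TopologicalSpace X]
    [SecondCountableTopology X] [LocallyCompactSpace X] :
    (Prod.instMeasurableSpace : MeasurableSpace (C(X, ℝ) × C(X, ℝ))) =
      ⨆ t : X ⊕ X, MeasurableSpace.comap
        (Sum.elim (fun x (p : C(X, ℝ) × C(X, ℝ)) => p.1 x) (fun x p => p.2 x) t)
        inferInstance := by
  rw [iSup_sum, Prod.instMeasurableSpace, MeasurableSpace.prod, instMeasurableSpace_eq_iSup_comap,
    MeasurableSpace.comap_iSup, MeasurableSpace.comap_iSup]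
  simp only [MeasurableSpace.comap_comp]
  rfl

/-- The restrictions to the balls of the half-space of a function `f` and of its reflection. -/
noncomputable def reflectionPair {d : ℕ} [NeZero d] (f : C(BallSpace d, ℝ)) :
    C(halfBalls d, ℝ) × C(halfBalls d, ℝ) :=
  (f.restrict (halfBalls d), (actFun (reflection d).symm f).restrict (halfBalls d))

/-- The restrictions to the balls of the half-space of `z + u` and `z + u'`, for a triple
`(z, u, u')`. -/
noncomputable def sharedPair {d : ℕ} [NeZero d]
    (p : C(BallSpace d, ℝ) × C(BallSpace d, ℝ) × C(BallSpace d, ℝ)) :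
    C(halfBalls d, ℝ) × C(halfBalls d, ℝ) :=
  ((p.1 + p.2.1).restrict (halfBalls d), (p.1 + p.2.2).restrict (halfBalls d))

theorem measurable_reflectionPair {d : ℕ} [NeZero d] : Measurable (reflectionPair (d := d)) :=
  measurable_map_prod_of_eval (fun x => measurable_eval x.1)
    (fun x => measurable_eval (actBall (reflection d).symm.symm x.1))

theorem measurable_sharedPair {d : ℕ} [NeZero d] : Measurable (sharedPair (d := d)) :=
  measurable_map_prod_of_eval
    (fun x => ((measurable_eval x.1).comp measurable_fst).add
      ((measurable_eval x.1).comp (measurable_fst.comp measurable_snd)))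
    (fun x => ((measurable_eval x.1).comp measurable_fst).add
      ((measurable_eval x.1).comp (measurable_snd.comp measurable_snd)))

theorem measurable_sum_elim_eval {X : Type*} [TopologicalSpace X] (t : X ⊕ X) :
    Measurable (Sum.elim (fun x (p : C(X, ℝ) × C(X, ℝ)) => p.1 x) (fun x p => p.2 x) t) := by
  rcases t with x | x
  · exact (measurable_eval x).comp measurable_fst
  · exact (measurable_eval x).comp measurable_snd

/-- The field and its reflection, on the balls of the half-space, are jointly distributed as `Z + U`
and `Z + U'` with `Z`, `U`, `U'` independent. -/
theorem map_reflectionPair_eq {d : ℕ} [NeZero d] {A : L2 d →L[ℝ] L2 d}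
    (hA : IsStrictlyPositiveOperator A)
    (hθ : ∀ f : L2 d, A (actL2 (reflection d) f) = actL2 (reflection d) (A f))
    {ν κ ρ : Measure C(BallSpace d, ℝ)} (hν : IsFieldMeasure A ν)
    (hκ : IsFieldMeasure (sharedPart A) κ) (hρ : IsFieldMeasure (residualPart A) ρ) :
    ν.map reflectionPair = (κ.prod (ρ.prod ρ)).map sharedPair := by
  have := hν.isProbabilityMeasure
  have := hκ.isProbabilityMeasure
  have := hρ.isProbabilityMeasure
  have := Measure.isProbabilityMeasure_map (μ := ν)
    (measurable_reflectionPair (d := d)).aemeasurable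
  have := Measure.isProbabilityMeasure_map (μ := κ.prod (ρ.prod ρ))
    (measurable_sharedPair (d := d)).aemeasurable
  refine measure_ext_of_integral_cexp_sum _ (prod_instMeasurableSpace_eq_iSup (halfBalls d))
    fun I c => ?_
  have hmeas : Measurable fun p : C(halfBalls d, ℝ) × C(halfBalls d, ℝ) =>
      Complex.exp ((∑ t ∈ I, c t * Sum.elim (fun x (p : C(halfBalls d, ℝ) × C(halfBalls d, ℝ)) =>
        p.1 x) (fun x p => p.2 x) t p : ℝ) * Complex.I) := by
    have : Measurable fun p : C(halfBalls d, ℝ) × C(halfBalls d, ℝ) =>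
        ∑ t ∈ I, c t * Sum.elim (fun x (p : C(halfBalls d, ℝ) × C(halfBalls d, ℝ)) =>
          p.1 x) (fun x p => p.2 x) t p :=
      Finset.measurable_fun_sum _ fun t _ => (measurable_sum_elim_eval t).const_mul _
    fun_prop
  rw [integral_map measurable_reflectionPair.aemeasurable hmeas.aestronglyMeasurable,
    integral_map measurable_sharedPair.aemeasurable hmeas.aestronglyMeasurable]
  set β : halfBalls d ⊕ halfBalls d → BallSpace d := Sum.elim Subtype.val Subtype.val with hβ
  set γ : halfBalls d ⊕ halfBalls d → BallSpace d :=
    Sum.elim Subtype.val fun b => actBall (reflection d) b.1 with hγ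
  -- The coefficients `c` split into those of the field, `l`, and those of its reflection, `r`.
  set l : halfBalls d ⊕ halfBalls d → ℝ := Sum.elim (fun b => c (.inl b)) 0 with hl
  set r : halfBalls d ⊕ halfBalls d → ℝ := Sum.elim 0 fun b => c (.inr b) with hr
  set y := ∑ t ∈ I, l t • ballVec (β t) with hy
  set z := ∑ t ∈ I, r t • ballVec (β t) with hz
  have hβmem : ∀ t, β t ∈ halfBalls d := by rintro (b | b) <;> exact b.2
  have hymem : y ∈ (smoothHalf d).topologicalClosure :=
    Submodule.sum_mem _ fun t _ => Submodule.smul_mem _ _ (ballVec_mem_closure_smoothHalf (hβmem t))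
  have hzmem : z ∈ (smoothHalf d).topologicalClosure :=
    Submodule.sum_mem _ fun t _ => Submodule.smul_mem _ _ (ballVec_mem_closure_smoothHalf (hβmem t))
  have hyz : ∑ t ∈ I, c t • ballVec (β t) = y + z := by
    rw [hy, hz, ← Finset.sum_add_distrib]
    refine Finset.sum_congr rfl ?_
    rintro (b | b) _ <;> simp [hl, hr]
  have hyθz : ∑ t ∈ I, c t • ballVec (γ t) = y + actL2 (reflection d) z := by
    rw [hy, hz, map_sum, ← Finset.sum_add_distrib]
    refine Finset.sum_congr rfl ?_
    rintro (b | b) _ <;> simp [hl, hr, hγ, hβ, actL2_ballVec]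
  have hleft : ∀ f : C(BallSpace d, ℝ), (∑ t ∈ I, c t *
      Sum.elim (fun x (p : C(halfBalls d, ℝ) × C(halfBalls d, ℝ)) => p.1 x) (fun x p => p.2 x) t
        (reflectionPair f)) = ∑ t ∈ I, c t * f (γ t) := by
    intro f
    refine Finset.sum_congr rfl ?_
    rintro (b | b) _ <;> rfl
  have hright : ∀ p : C(BallSpace d, ℝ) × C(BallSpace d, ℝ) × C(BallSpace d, ℝ), (∑ t ∈ I, c t *
      Sum.elim (fun x (p : C(halfBalls d, ℝ) × C(halfBalls d, ℝ)) => p.1 x) (fun x p => p.2 x) t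
        (sharedPair p)) = ∑ t ∈ I, c t * p.1 (β t) +
          (∑ t ∈ I, l t * p.2.1 (β t) + ∑ t ∈ I, r t * p.2.2 (β t)) := by
    intro p
    rw [← Finset.sum_add_distrib, ← Finset.sum_add_distrib]
    refine Finset.sum_congr rfl ?_
    rintro (b | b) _ <;> simp [hl, hr, hβ, sharedPair] <;> ring
  have hexp : ∀ u v w : ℝ, Complex.exp ((u + (v + w) : ℝ) * Complex.I) =
      Complex.exp (u * Complex.I) *
        (Complex.exp (v * Complex.I) * Complex.exp (w * Complex.I)) := by
    intro u v w
    rw [← Complex.exp_add, ← Complex.exp_add]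
    push_cast
    ring_nf
  simp only [hleft, hright, hexp]
  rw [integral_prod_mul (fun f : C(BallSpace d, ℝ) =>
      Complex.exp ((∑ t ∈ I, c t * f (β t) : ℝ) * Complex.I))
    (fun q : C(BallSpace d, ℝ) × C(BallSpace d, ℝ) =>
      Complex.exp ((∑ t ∈ I, l t * q.1 (β t) : ℝ) * Complex.I) *
        Complex.exp ((∑ t ∈ I, r t * q.2 (β t) : ℝ) * Complex.I)),
    integral_prod_mul (fun f : C(BallSpace d, ℝ) =>
      Complex.exp ((∑ t ∈ I, l t * f (β t) : ℝ) * Complex.I))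
    (fun f : C(BallSpace d, ℝ) => Complex.exp ((∑ t ∈ I, r t * f (β t) : ℝ) * Complex.I)),
    hν.integral_cexp_sum, hκ.integral_cexp_sum, hρ.integral_cexp_sum, hρ.integral_cexp_sum,
    hyz, hyθz, ← hy, ← hz, inner_add_actL2_eq hA hθ hymem hzmem, ← Complex.exp_add,
    ← Complex.exp_add]
  push_cast
  ring_nf

theorem IsFieldMeasure.isReflectionPositiveMeasure {d : ℕ} [NeZero d] {A : L2 d →L[ℝ] L2 d}
    {ν : Measure C(BallSpace d, ℝ)} (hν : IsFieldMeasure A ν) (hA : IsStrictlyPositiveOperator A)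
    (hθ : ∀ f : L2 d, A (actL2 (reflection d) f) = actL2 (reflection d) (A f))
    (hRP : IsReflectionPositiveOperator A) : IsReflectionPositiveMeasure ν := by
  obtain ⟨κ, hκ⟩ := exists_isFieldMeasure (sharedPart A)
    (fun x y => by
      rw [inner_sharedPart, inner_sharedPart, inner_apply_actL2_comm hA hθ])
    (fun x => by
      rw [inner_sharedPart, hA.inner_comm, real_inner_comm]
      exact hRP.inner_nonneg (halfProj_mem x))
  obtain ⟨ρ, hρ⟩ := exists_isFieldMeasure (residualPart A)
    (fun x y => by
      rw [inner_residualPart, inner_residualPart, inner_apply_actL2_comm hA hθ, hA.inner_comm])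
    (inner_residualPart_nonneg hA hθ)
  have := hν.isProbabilityMeasure
  have := hκ.isProbabilityMeasure
  have := hρ.isProbabilityMeasure
  rintro Ψ ⟨Ψ', hΨ'm, ⟨K, hK⟩, hΨ⟩
  set G : C(halfBalls d, ℝ) × C(halfBalls d, ℝ) → ℂ := fun p => Ψ' p.1 * conj (Ψ' p.2) with hG
  have hGm : Measurable G := (hΨ'm.comp measurable_fst).mul
    (Complex.continuous_conj.measurable.comp (hΨ'm.comp measurable_snd))
  set F : C(BallSpace d, ℝ) → C(BallSpace d, ℝ) → ℂ :=
    fun z u => Ψ' ((z + u).restrict (halfBalls d)) with hF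
  have hint : Integrable (fun p => G (sharedPair p)) (κ.prod (ρ.prod ρ)) := by
    refine Integrable.of_bound (C := K * K)
      (hGm.comp measurable_sharedPair).aestronglyMeasurable (Eventually.of_forall fun p => ?_)
    rw [hG, norm_mul, RCLike.norm_conj]
    exact mul_le_mul (hK _) (hK _) (norm_nonneg _) ((norm_nonneg _).trans (hK 0))
  have key : ∫ f, Ψ f * conj (Ψ (actFun (reflection d).symm f)) ∂ν =
      ((∫ z, Complex.normSq (∫ u, F z u ∂ρ) ∂κ : ℝ) : ℂ) := by
    calc ∫ f, Ψ f * conj (Ψ (actFun (reflection d).symm f)) ∂ν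
        = ∫ f, G (reflectionPair f) ∂ν := by
          refine integral_congr_ae (Eventually.of_forall fun f => ?_)
          simp only [hΨ]
          rfl
      _ = ∫ p, G (sharedPair p) ∂(κ.prod (ρ.prod ρ)) := by
          rw [← integral_map measurable_reflectionPair.aemeasurable hGm.aestronglyMeasurable,
            map_reflectionPair_eq hA hθ hν hκ hρ,
            integral_map measurable_sharedPair.aemeasurable hGm.aestronglyMeasurable]
      _ = ∫ z, ∫ q, F z q.1 * conj (F z q.2) ∂(ρ.prod ρ) ∂κ := integral_prod _ hint
      _ = ∫ z, ((Complex.normSq (∫ u, F z u ∂ρ) : ℝ) : ℂ) ∂κ := by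
          refine integral_congr_ae (Eventually.of_forall fun z => ?_)
          simp only
          -- Given `z`, the two factors are independent and identically distributed.
          rw [integral_prod_mul (F z) (fun u => conj (F z u)), integral_conj, Complex.mul_conj]
      _ = _ := integral_complex_ofReal
  rw [key, Complex.ofReal_re, Complex.ofReal_im]
  exact ⟨integral_nonneg fun z => Complex.normSq_nonneg _, rfl⟩

end BallField

theorem mainTheorem4 (d : ℕ) [NeZero d]
    (A : BallField.L2 d →L[ℝ] BallField.L2 d)
    (hA : BallField.IsStrictlyPositiveOperator A) :
    (∃! ν : MeasureTheory.Measure C(BallField.BallSpace d, ℝ), BallField.IsFieldMeasure A ν) ∧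
    ∀ ν : MeasureTheory.Measure C(BallField.BallSpace d, ℝ), BallField.IsFieldMeasure A ν →
      (BallField.IsInvariantOperator A → BallField.IsInvariantMeasure ν) ∧
      ((∀ f : BallField.L2 d, A (BallField.actL2 (BallField.reflection d) f) =
          BallField.actL2 (BallField.reflection d) (A f)) →
        BallField.IsReflectionPositiveOperator A → BallField.IsReflectionPositiveMeasure ν) := by
  obtain ⟨ν, hν⟩ := BallField.exists_isFieldMeasure A hA.inner_comm hA.inner_nonneg
  exact ⟨⟨ν, hν, fun ν' hν' => hν'.unique hν⟩, fun ν' hν' =>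
    ⟨hν'.isInvariantMeasure, hν'.isReflectionPositiveMeasure hA⟩⟩
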